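/- Let $K$ be a field with $\operatorname{char} K\neq 2$, let $m\ge 2$ and $n\ge 3$ be integers, and let $q\in K$ be a primitive $m$-th root of unity. Let $T_{m^2}(q)$ be the Taft Hopf algebra over $K$: the algebra generated by $h$ and $x$ subject to $h^m=1$, $x^m=0$, $xh=q\,hx$, with comultiplication $\Delta(h)=h\otimes h$, $\Delta(x)=x\otimes h+1\otimes x$, counit $\varepsilon(h)=1$, $\varepsilon(x)=0$, and antipode $S(h)=h^{m-1}$, $S(x)=-xh^{m-1}$. Let $K[D_{2n}]$ be the group Hopf algebra of the dihedral group $D_{2n}$ of order $2n$. A Hopf algebra $E$ over $K$ is said to factorize through two Hopf algebras $A$ and $H$ if there exist injective Hopf algebra maps $i:A\to E$ and $j:H\to E$ such that the linear map $A\otimes H\to E$, $a\otimes y\mapsto i(a)j(y)$, is bijective. Then the number of isomorphism types of Hopf algebras over $K$ that factorize through $T_{m^2}(q)$ and $K[D_{2n}]$ is $$\begin{cases}2,&\text{if } m \text{ and } n \text{ are both odd},\\ 3,&\text{if } m \text{ is odd and } n \text{ is even},\\ 1,&\text{if } m \text{ is even}.\end{cases}$$ -/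

import Mathlib

universe u v w

noncomputable section

namespace TaftBicrossed

open scoped TensorProduct

/-! ### Vanishing of a `q`-binomial power -/

/-- Gaussian binomial coefficients, defined by their `q`-Pascal recursion. -/
def gaussBinom {K : Type u} [Field K] (q : K) : ℕ → ℕ → K
  | _, 0 => 1
  | 0, _ + 1 => 0
  | n + 1, k + 1 => gaussBinom q n k + q ^ (k + 1) * gaussBinom q n (k + 1)

theorem gaussBinom_zero_right {K : Type u} [Field K] (q : K) (n : ℕ) :
    gaussBinom q n 0 = 1 := by
  cases n <;> rfl

theorem gaussBinom_succ_succ {K : Type u} [Field K] (q : K) (n k : ℕ) :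
    gaussBinom q (n + 1) (k + 1) =
      gaussBinom q n k + q ^ (k + 1) * gaussBinom q n (k + 1) := rfl

theorem gaussBinom_absorb {K : Type u} [Field K] (q : K) (n : ℕ) :
    ∀ k, (1 - q ^ (k + 1)) * gaussBinom q (n + 1) (k + 1) =
      (1 - q ^ (n + 1)) * gaussBinom q n k := by
  induction n with
  | zero =>
    intro k
    cases k with
    | zero => simp [gaussBinom]
    | succ k => simp [gaussBinom]
  | succ n ih =>
    intro k
    rw [gaussBinom_succ_succ q (n + 1) k]
    have h1 := ih k
    cases k with
    | zero =>
      simp only [gaussBinom_zero_right] at h1 ⊢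
      linear_combination q * h1
    | succ k =>
      have h2 := ih k
      have h3 := gaussBinom_succ_succ q n k
      linear_combination q ^ (k + 2) * h1 + q * h2 - q * (1 - q ^ (n + 1)) * h3

theorem gaussBinom_eq_zero_of_lt {K : Type u} [Field K] (q : K) :
    ∀ n k, n < k → gaussBinom q n k = 0 := by
  intro n
  induction n with
  | zero =>
    intro k hk
    cases k with
    | zero => omega
    | succ k => rfl
  | succ n ih =>
    intro k hk
    cases k with
    | zero => omega
    | succ k =>
      rw [gaussBinom_succ_succ, ih k (by omega), ih (k + 1) (by omega)]
      ring

theorem mul_pow_of_qcomm {K : Type u} [Field K] {R : Type v} [Ring R] [Algebra K R]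
    {q : K} {a b : R} (hab : b * a = q • (a * b)) (i : ℕ) :
    b * a ^ i = q ^ i • (a ^ i * b) := by
  induction i with
  | zero => simp
  | succ i ih =>
    rw [pow_succ, ← mul_assoc, ih, smul_mul_assoc, mul_assoc, hab, mul_smul_comm, smul_smul,
      ← pow_succ, mul_assoc]

theorem add_pow_of_qcomm {K : Type u} [Field K] {R : Type v} [Ring R] [Algebra K R]
    {q : K} {a b : R} (hab : b * a = q • (a * b)) (n : ℕ) :
    (a + b) ^ n =
      ∑ i ∈ Finset.range (n + 1), gaussBinom q n i • (a ^ i * b ^ (n - i)) := by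
  induction n with
  | zero => simp [gaussBinom]
  | succ n ih =>
    have hb : b * ∑ i ∈ Finset.range (n + 1), gaussBinom q n i • (a ^ i * b ^ (n - i)) =
        ∑ i ∈ Finset.range (n + 2),
          (q ^ i * gaussBinom q n i) • (a ^ i * b ^ (n + 1 - i)) := by
      rw [Finset.sum_range_succ _ (n + 1), gaussBinom_eq_zero_of_lt q n (n + 1) (by omega),
        mul_zero, zero_smul, add_zero, Finset.mul_sum]
      refine Finset.sum_congr rfl fun i hi => ?_
      have hi' : n + 1 - i = (n - i) + 1 := by
        have := Finset.mem_range.1 hi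
        omega
      rw [mul_smul_comm, ← mul_assoc, mul_pow_of_qcomm hab, smul_mul_assoc, smul_smul, mul_assoc,
        ← pow_succ', hi', mul_comm (q ^ i)]
    have ha : a * ∑ i ∈ Finset.range (n + 1), gaussBinom q n i • (a ^ i * b ^ (n - i)) =
        ∑ i ∈ Finset.range (n + 1),
          gaussBinom q n i • (a ^ (i + 1) * b ^ (n + 1 - (i + 1))) := by
      rw [Finset.mul_sum]
      refine Finset.sum_congr rfl fun i _ => ?_
      rw [mul_smul_comm, ← mul_assoc, ← pow_succ', Nat.add_sub_add_right]
    rw [pow_succ', ih, add_mul, ha, hb, Finset.sum_range_succ' _ (n + 1),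
      Finset.sum_range_succ' _ (n + 1), ← add_assoc, ← Finset.sum_add_distrib]
    simp only [gaussBinom_succ_succ, add_smul, gaussBinom_zero_right, pow_zero, one_mul, one_smul]

theorem add_pow_eq_zero_of_qcomm {K : Type u} [Field K] {R : Type v} [Ring R] [Algebra K R]
    {m : ℕ} {q : K} (hm : 2 ≤ m) (hq : IsPrimitiveRoot q m) {a b : R}
    (hab : b * a = q • (a * b)) (ha : a ^ m = 0) (hb : b ^ m = 0) : (a + b) ^ m = 0 := by
  rw [add_pow_of_qcomm hab]
  refine Finset.sum_eq_zero fun i hi => ?_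
  have hi' := Finset.mem_range.1 hi
  rcases Nat.eq_zero_or_pos i with rfl | h0
  · simp [hb]
  rcases Nat.eq_or_lt_of_le (Nat.lt_succ_iff.1 hi') with rfl | h1
  · simp [ha]
  obtain ⟨k, rfl⟩ : ∃ k, i = k + 1 := ⟨i - 1, by omega⟩
  obtain ⟨n, rfl⟩ : ∃ n, m = n + 1 := ⟨m - 1, by omega⟩
  have h := gaussBinom_absorb q n k
  rw [hq.pow_eq_one, sub_self, zero_mul] at h
  have h2 : (1 : K) - q ^ (k + 1) ≠ 0 :=
    sub_ne_zero.2 (hq.pow_ne_one_of_pos_of_lt (by omega) h1).symm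
  rw [(mul_eq_zero.1 h).resolve_left h2, zero_smul]

theorem mul_pow_eq_zero_of_qcomm {K : Type u} [Field K] {R : Type v} [Ring R] [Algebra K R]
    {m : ℕ} {q : K} {x g : R} (hab : g * x = q • (x * g)) (hx : x ^ m = 0) :
    (x * g) ^ m = 0 := by
  have key : ∀ k, ∃ s : K, (x * g) ^ k = s • (x ^ k * g ^ k) := by
    intro k
    induction k with
    | zero => exact ⟨1, by simp⟩
    | succ k ih =>
      obtain ⟨s, hs⟩ := ih
      refine ⟨s * q ^ k, ?_⟩
      rw [pow_succ', hs, mul_smul_comm, mul_assoc, ← mul_assoc g, mul_pow_of_qcomm hab,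
        smul_mul_assoc, mul_smul_comm, smul_smul, mul_assoc (x ^ k), ← pow_succ', ← mul_assoc,
        ← pow_succ']
  obtain ⟨s, hs⟩ := key m
  rw [hs, hx, zero_mul, smul_zero]

/-! ### The Taft Hopf algebra -/

/-- The two generators of the Taft algebra. -/
inductive TaftGen : Type
  | h : TaftGen
  | x : TaftGen

/-- The defining relations `h ^ m = 1`, `x ^ m = 0`, `x h = q h x` of the Taft algebra. -/
inductive TaftRel {K : Type u} [Field K] (m : ℕ) (q : K) :
    FreeAlgebra K TaftGen → FreeAlgebra K TaftGen → Prop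
  | h_pow : TaftRel m q (FreeAlgebra.ι K TaftGen.h ^ m) 1
  | x_pow : TaftRel m q (FreeAlgebra.ι K TaftGen.x ^ m) 0
  | x_mul_h : TaftRel m q (FreeAlgebra.ι K TaftGen.x * FreeAlgebra.ι K TaftGen.h)
      (q • (FreeAlgebra.ι K TaftGen.h * FreeAlgebra.ι K TaftGen.x))

/-- The Taft algebra `T_{m²}(q)` of order `m ≥ 2`, where `q` is a primitive `m`-th root of unity:
the `K`-algebra generated by `h` and `x` subject to `h ^ m = 1`, `x ^ m = 0`, `x h = q h x`. The
hypotheses on `m` and `q` are recorded in the type because the Hopf algebra structure needs them. -/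
@[nolint unusedArguments]
def Taft {K : Type u} [Field K] {m : ℕ} {q : K} (_hm : 2 ≤ m) (_hq : IsPrimitiveRoot q m) :
    Type u :=
  RingQuot (TaftRel m q)

namespace Taft

variable {K : Type u} [Field K] {m : ℕ} {q : K} (hm : 2 ≤ m) (hq : IsPrimitiveRoot q m)

instance : Ring (Taft hm hq) := inferInstanceAs (Ring (RingQuot (TaftRel m q)))

instance : Algebra K (Taft hm hq) := inferInstanceAs (Algebra K (RingQuot (TaftRel m q)))

/-- The quotient map from the free algebra. -/
def mk : FreeAlgebra K TaftGen →ₐ[K] Taft hm hq := RingQuot.mkAlgHom K (TaftRel m q)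

/-- The generator `h`. -/
def h : Taft hm hq := mk hm hq (FreeAlgebra.ι K TaftGen.h)

/-- The generator `x`. -/
def x : Taft hm hq := mk hm hq (FreeAlgebra.ι K TaftGen.x)

theorem h_pow : h hm hq ^ m = 1 := by
  have := RingQuot.mkAlgHom_rel K (TaftRel.h_pow (m := m) (q := q))
  rw [map_pow, map_one] at this
  exact this

theorem x_pow : x hm hq ^ m = 0 := by
  have := RingQuot.mkAlgHom_rel K (TaftRel.x_pow (m := m) (q := q))
  rw [map_pow, map_zero] at this
  exact this

theorem x_mul_h : x hm hq * h hm hq = q • (h hm hq * x hm hq) := by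
  have := RingQuot.mkAlgHom_rel K (TaftRel.x_mul_h (m := m) (q := q))
  rw [map_mul, map_smul, map_mul] at this
  exact this

/-- The universal property of the presentation. -/
def lift {B : Type v} [Ring B] [Algebra K B] (a b : B) (ha : a ^ m = 1) (hb : b ^ m = 0)
    (hab : b * a = q • (a * b)) : Taft hm hq →ₐ[K] B :=
  RingQuot.liftAlgHom K ⟨FreeAlgebra.lift K (fun g => TaftGen.casesOn g a b), by
    intro y z hyz
    cases hyz <;> simp [ha, hb, hab]⟩

theorem lift_h {B : Type v} [Ring B] [Algebra K B] (a b : B) (ha : a ^ m = 1) (hb : b ^ m = 0)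
    (hab : b * a = q • (a * b)) : lift hm hq a b ha hb hab (h hm hq) = a :=
  (RingQuot.liftAlgHom_mkAlgHom_apply K _ _ _).trans (by simp)

theorem lift_x {B : Type v} [Ring B] [Algebra K B] (a b : B) (ha : a ^ m = 1) (hb : b ^ m = 0)
    (hab : b * a = q • (a * b)) : lift hm hq a b ha hb hab (x hm hq) = b :=
  (RingQuot.liftAlgHom_mkAlgHom_apply K _ _ _).trans (by simp)

variable {hm hq} in
theorem algHom_ext {B : Type v} [Semiring B] [Algebra K B] {f g : Taft hm hq →ₐ[K] B}
    (h1 : f (h hm hq) = g (h hm hq)) (h2 : f (x hm hq) = g (x hm hq)) : f = g := by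
  apply RingQuot.ringQuot_ext' K
  apply FreeAlgebra.hom_ext
  funext i
  cases i
  · exact h1
  · exact h2

variable {hm hq} in
theorem induction {P : Taft hm hq → Prop} (h_alg : ∀ r : K, P (algebraMap K _ r))
    (h_h : P (h hm hq)) (h_x : P (x hm hq)) (h_mul : ∀ a b, P a → P b → P (a * b))
    (h_add : ∀ a b, P a → P b → P (a + b)) (a : Taft hm hq) : P a := by
  obtain ⟨a, rfl⟩ := RingQuot.mkAlgHom_surjective K (TaftRel m q) a
  change P (mk hm hq a)
  induction a using FreeAlgebra.induction with
  | grade0 r => rw [AlgHom.commutes]; exact h_alg r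
  | grade1 i =>
    cases i
    · exact h_h
    · exact h_x
  | mul a b iha ihb => rw [map_mul]; exact h_mul _ _ iha ihb
  | add a b iha ihb => rw [map_add]; exact h_add _ _ iha ihb

/-- The comultiplication: `Δ h = h ⊗ h` and `Δ x = x ⊗ h + 1 ⊗ x`. -/
def comulHom : Taft hm hq →ₐ[K] Taft hm hq ⊗[K] Taft hm hq :=
  lift hm hq (h hm hq ⊗ₜ h hm hq) (x hm hq ⊗ₜ h hm hq + 1 ⊗ₜ x hm hq)
    (by rw [Algebra.TensorProduct.tmul_pow, h_pow, Algebra.TensorProduct.one_def])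
    (by
      apply add_pow_eq_zero_of_qcomm hm hq
      · rw [Algebra.TensorProduct.tmul_mul_tmul, Algebra.TensorProduct.tmul_mul_tmul, x_mul_h,
          one_mul, mul_one, TensorProduct.tmul_smul]
      · rw [Algebra.TensorProduct.tmul_pow, x_pow, TensorProduct.zero_tmul]
      · rw [Algebra.TensorProduct.tmul_pow, x_pow, TensorProduct.tmul_zero])
    (by
      simp only [add_mul, mul_add, smul_add, Algebra.TensorProduct.tmul_mul_tmul, x_mul_h,
        one_mul, mul_one, TensorProduct.tmul_smul]
      rw [← TensorProduct.smul_tmul'])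

/-- The counit: `ε h = 1` and `ε x = 0`. -/
def counitHom : Taft hm hq →ₐ[K] K :=
  lift hm hq 1 0 (one_pow m) (zero_pow (by omega)) (by simp)

theorem comulHom_h : comulHom hm hq (h hm hq) = h hm hq ⊗ₜ h hm hq := lift_h ..

theorem comulHom_x :
    comulHom hm hq (x hm hq) = x hm hq ⊗ₜ h hm hq + 1 ⊗ₜ x hm hq := lift_x ..

theorem counitHom_h : counitHom hm hq (h hm hq) = 1 := lift_h ..

theorem counitHom_x : counitHom hm hq (x hm hq) = 0 := lift_x ..

instance : Bialgebra K (Taft hm hq) :=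
  Bialgebra.ofAlgHom (comulHom hm hq) (counitHom hm hq)
    (by
      apply algHom_ext
      · simp [comulHom_h]
      · simp [comulHom_x, comulHom_h, TensorProduct.add_tmul, TensorProduct.tmul_add,
          Algebra.TensorProduct.one_def, add_assoc])
    (by
      apply algHom_ext
      · simp [comulHom_h, counitHom_h]
      · simp [comulHom_x, counitHom_x])
    (by
      apply algHom_ext
      · simp [comulHom_h, counitHom_h]
      · simp [comulHom_x, counitHom_x, counitHom_h])

theorem comul_h : Coalgebra.comul (R := K) (h hm hq) = h hm hq ⊗ₜ h hm hq := comulHom_h hm hq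

theorem comul_x :
    Coalgebra.comul (R := K) (x hm hq) = x hm hq ⊗ₜ h hm hq + 1 ⊗ₜ x hm hq := comulHom_x hm hq

theorem counit_h : Coalgebra.counit (R := K) (h hm hq) = 1 := counitHom_h hm hq

theorem counit_x : Coalgebra.counit (R := K) (x hm hq) = 0 := counitHom_x hm hq

theorem h_mul_h_pow_pred : h hm hq * h hm hq ^ (m - 1) = 1 := by
  rw [← pow_succ', Nat.sub_add_cancel (by omega), h_pow]

theorem h_pow_pred_mul_h : h hm hq ^ (m - 1) * h hm hq = 1 := by
  rw [← pow_succ, Nat.sub_add_cancel (by omega), h_pow]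

theorem h_pow_pred_mul_x :
    h hm hq ^ (m - 1) * x hm hq = q • (x hm hq * h hm hq ^ (m - 1)) := by
  calc h hm hq ^ (m - 1) * x hm hq
      = h hm hq ^ (m - 1) * (x hm hq * h hm hq) * h hm hq ^ (m - 1) := by
        rw [mul_assoc, mul_assoc, h_mul_h_pow_pred, mul_one]
    _ = q • ((h hm hq ^ (m - 1) * h hm hq) * x hm hq * h hm hq ^ (m - 1)) := by
        rw [x_mul_h, mul_smul_comm, smul_mul_assoc, mul_assoc (h hm hq ^ (m - 1)) (h hm hq)]
    _ = q • (x hm hq * h hm hq ^ (m - 1)) := by rw [h_pow_pred_mul_h, one_mul]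

/-- The antipode as an algebra map to the opposite algebra: `S h = h ^ (m - 1)` and
`S x = - x h ^ (m - 1)`. -/
def antipodeHom : Taft hm hq →ₐ[K] (Taft hm hq)ᵐᵒᵖ :=
  lift hm hq (MulOpposite.op (h hm hq ^ (m - 1)))
    (MulOpposite.op (-(x hm hq * h hm hq ^ (m - 1))))
    (by rw [← MulOpposite.op_pow, ← pow_mul, mul_comm, pow_mul, h_pow, one_pow,
          MulOpposite.op_one])
    (by rw [← MulOpposite.op_pow, neg_pow, mul_pow_eq_zero_of_qcomm (h_pow_pred_mul_x hm hq)
          (x_pow hm hq), mul_zero, MulOpposite.op_zero])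
    (by rw [← MulOpposite.op_mul, ← MulOpposite.op_mul, ← MulOpposite.op_smul, mul_neg, neg_mul,
          ← mul_assoc, h_pow_pred_mul_x, smul_mul_assoc, smul_neg])

/-- The antipode as a linear map. -/
def antipode : Taft hm hq →ₗ[K] Taft hm hq :=
  (MulOpposite.opLinearEquiv K).symm.toLinearMap ∘ₗ (antipodeHom hm hq).toLinearMap

theorem antipode_algebraMap (r : K) :
    antipode hm hq (algebraMap K _ r) = algebraMap K _ r := by
  simp [antipode]

theorem antipode_h : antipode hm hq (h hm hq) = h hm hq ^ (m - 1) := by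
  have : antipodeHom hm hq (h hm hq) = MulOpposite.op (h hm hq ^ (m - 1)) := lift_h ..
  simp [antipode, this]

theorem antipode_x : antipode hm hq (x hm hq) = -(x hm hq * h hm hq ^ (m - 1)) := by
  have : antipodeHom hm hq (x hm hq) = MulOpposite.op (-(x hm hq * h hm hq ^ (m - 1))) :=
    lift_x ..
  simp [antipode, this]

theorem antipode_mul (a b : Taft hm hq) :
    antipode hm hq (a * b) = antipode hm hq b * antipode hm hq a := by
  simp [antipode]

theorem antipode_left (a : Taft hm hq) :
    LinearMap.mul' K _ ((antipode hm hq).rTensor _ (Coalgebra.comul a)) =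
      algebraMap K _ (Coalgebra.counit a) := by
  induction a using induction with
  | h_alg r =>
    rw [Bialgebra.comul_algebraMap, Bialgebra.counit_algebraMap,
      Algebra.TensorProduct.algebraMap_apply, LinearMap.rTensor_tmul, LinearMap.mul'_apply,
      antipode_algebraMap, mul_one]
  | h_h => simp [comul_h, counit_h, antipode_h, h_pow_pred_mul_h]
  | h_x =>
    have h1 := antipode_algebraMap hm hq 1
    rw [map_one] at h1
    simp [comul_x, counit_x, antipode_x, h1, mul_assoc, h_pow_pred_mul_h]
  | h_mul a b ha hb =>
    have key : ∀ s t : Taft hm hq ⊗[K] Taft hm hq,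
        LinearMap.mul' K _ ((antipode hm hq).rTensor _ s) = algebraMap K _ (Coalgebra.counit a) →
        LinearMap.mul' K _ ((antipode hm hq).rTensor _ (s * t)) =
          Coalgebra.counit (R := K) a • LinearMap.mul' K _ ((antipode hm hq).rTensor _ t) := by
      intro s t hs
      induction t with
      | zero => simp
      | add t t' ht ht' => rw [mul_add, map_add, map_add, map_add, map_add, smul_add, ht, ht']
      | tmul c d =>
        have : ∀ s : Taft hm hq ⊗[K] Taft hm hq,
            LinearMap.mul' K _ ((antipode hm hq).rTensor _ (s * c ⊗ₜ d)) =
              antipode hm hq c * LinearMap.mul' K _ ((antipode hm hq).rTensor _ s) * d := by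
          intro s
          induction s with
          | zero => simp
          | add s s' hs hs' => rw [add_mul, map_add, map_add, map_add, map_add, mul_add, add_mul,
              hs, hs']
          | tmul e f => simp [antipode_mul, mul_assoc]
        rw [this, hs, LinearMap.rTensor_tmul, LinearMap.mul'_apply, ← Algebra.commutes, mul_assoc,
          Algebra.smul_def]
    rw [Bialgebra.comul_mul, key _ _ ha, hb, Bialgebra.counit_mul, map_mul, Algebra.smul_def]
  | h_add a b ha hb => simp only [map_add, ha, hb]

theorem antipode_right (a : Taft hm hq) :
    LinearMap.mul' K _ ((antipode hm hq).lTensor _ (Coalgebra.comul a)) =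
      algebraMap K _ (Coalgebra.counit a) := by
  induction a using induction with
  | h_alg r =>
    have h1 := antipode_algebraMap hm hq 1
    rw [map_one] at h1
    rw [Bialgebra.comul_algebraMap, Bialgebra.counit_algebraMap,
      Algebra.TensorProduct.algebraMap_apply, LinearMap.lTensor_tmul, LinearMap.mul'_apply,
      h1, mul_one]
  | h_h => simp [comul_h, counit_h, antipode_h, h_mul_h_pow_pred]
  | h_x => simp [comul_x, counit_x, antipode_x, antipode_h]
  | h_mul a b ha hb =>
    have key : ∀ s t : Taft hm hq ⊗[K] Taft hm hq,
        LinearMap.mul' K _ ((antipode hm hq).lTensor _ t) = algebraMap K _ (Coalgebra.counit b) →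
        LinearMap.mul' K _ ((antipode hm hq).lTensor _ (s * t)) =
          Coalgebra.counit (R := K) b • LinearMap.mul' K _ ((antipode hm hq).lTensor _ s) := by
      intro s t ht
      induction s with
      | zero => simp
      | add s s' hs hs' => rw [add_mul, map_add, map_add, map_add, map_add, smul_add, hs, hs']
      | tmul c d =>
        have : ∀ t : Taft hm hq ⊗[K] Taft hm hq,
            LinearMap.mul' K _ ((antipode hm hq).lTensor _ (c ⊗ₜ d * t)) =
              c * LinearMap.mul' K _ ((antipode hm hq).lTensor _ t) * antipode hm hq d := by
          intro t
          induction t with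
          | zero => simp
          | add t t' ht ht' => rw [mul_add, map_add, map_add, map_add, map_add, mul_add, add_mul,
              ht, ht']
          | tmul e f => simp [antipode_mul, mul_assoc]
        rw [this, ht, LinearMap.lTensor_tmul, LinearMap.mul'_apply, ← Algebra.commutes, mul_assoc,
          Algebra.smul_def]
    rw [Bialgebra.comul_mul, key _ _ hb, ha, Bialgebra.counit_mul, map_mul, Algebra.smul_def,
      Algebra.commutes]
  | h_add a b ha hb => simp only [map_add, ha, hb]

/-- The Taft Hopf algebra: `Δ h = h ⊗ h`, `Δ x = x ⊗ h + 1 ⊗ x`, `ε h = 1`, `ε x = 0`,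
`S h = h ^ (m - 1)`, `S x = - x h ^ (m - 1)`. -/
instance : HopfAlgebra K (Taft hm hq) where
  antipode := antipode hm hq
  mul_antipode_rTensor_comul := LinearMap.ext (antipode_left hm hq)
  mul_antipode_lTensor_comul := LinearMap.ext (antipode_right hm hq)

end Taft

/-! ### Factorization of Hopf algebras -/

/-- The Hopf algebra `E` factorizes through the Hopf algebras `A` and `H`: there are injective
Hopf algebra maps `i : A → E` and `j : H → E` such that `A ⊗ H → E`, `a ⊗ y ↦ i a * j y`, is
bijective. (Bialgebra maps between Hopf algebras preserve the antipode automatically.) -/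
def FactorizesThrough (K : Type u) [Field K] (A H : Type v) [Ring A] [HopfAlgebra K A] [Ring H]
    [HopfAlgebra K H] (E : Type w) [Ring E] [HopfAlgebra K E] : Prop :=
  ∃ (i : A →ₐc[K] E) (j : H →ₐc[K] E), Function.Injective i ∧ Function.Injective j ∧
    Function.Bijective
      (LinearMap.mul' K E ∘ₗ TensorProduct.map (i : A →ₗ[K] E) (j : H →ₗ[K] E))

/-- Isomorphism of Hopf algebras on those that factorize through `A` and `H`. -/
def factorizationSetoid (K : Type u) [Field K] (A H : Type u) [Ring A] [HopfAlgebra K A] [Ring H]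
    [HopfAlgebra K H] : Setoid {E : HopfAlgCat.{u} K // FactorizesThrough K A H E} where
  r E F := Nonempty (E.1 ≃ₐc[K] F.1)
  iseqv :=
    { refl := fun E => ⟨BialgEquiv.refl K E.1⟩
      symm := fun ⟨e⟩ => ⟨e.symm⟩
      trans := fun ⟨e⟩ ⟨f⟩ => ⟨e.trans f⟩ }

/-- The isomorphism types of Hopf algebras that factorize through `A` and `H`. -/
def FactorizationTypes (K : Type u) [Field K] (A H : Type u) [Ring A] [HopfAlgebra K A] [Ring H]
    [HopfAlgebra K H] : Type (u + 1) :=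
  Quotient (factorizationSetoid K A H)

end TaftBicrossed

end

/-! Write `G` for the dihedral group. In a Hopf algebra `E` that factorizes, the elements `h ^ a * x
^ b * g` with `b < m` form a basis, and the q-binomial theorem gives their comultiplication.
Comparing coefficients of `Δ y` shows that the group-like elements are the `h ^ a * g`
(`exists_monomial_eq_of_isGroupLikeElem`), and that a solution of `Δ y = y ⊗ k + 1 ⊗ y` is a
combination of `1 - k` and, only when `k = h`, of `x` (`skewPrimitive_eq`). Conjugating `x` by `g`
gives such a solution that still q-commutes with its group-like element, so `g h g⁻¹ = h` and `g x
g⁻¹ = χ(g) x` for a character `χ` of `G` (`exists_hasCharacter`). Hence `E` is the smash product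
`Smash hm hq χ`. Conversely every `χ` occurs (`Smash.factorizesThrough`), so the task is to classify
these smash products.

An isomorphism from the smash product of `χ'` to that of `χ` fixes `h`, rescales `x` and sends `g`
to some `h ^ a(g) * v(g)` with `v` an injective endomorphism of `G`. Commutation with `x` then gives
`χ(v g) = χ'(g) q ^ a(g)`, so `χ'` and `χ ∘ v` have the same `m`-th power
(`HasCharacter.exists_pow_eq`).

Characters of a dihedral group take values `±1`. For `m` odd, `m`-th powers lose nothing: triviality
of `χ` is an invariant, and so is triviality on rotations, because `n ≥ 3` forces `v` to send `r 1`
to a rotation. For `n` odd there are two characters; for `n` even there are four, and the two that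
are `-1` on `r 1` are exchanged by an automorphism. For `m` even, `h ^ (m / 2)` anticommutes with
`x`; multiplying it into those `g` with `χ(g) = -1` makes the character trivial, and one type
remains. -/

noncomputable section

namespace TaftBicrossed

open scoped TensorProduct

/-! ### A monomial basis of the Taft algebra -/

/-- Powers with exponents in `ZMod m` of an element whose `m`-th power is one. -/
theorem pow_zmodVal_add {M : Type*} [Monoid M] {m : ℕ} [NeZero m] {y : M} (hy : y ^ m = 1)
    (a b : ZMod m) : y ^ (a + b).val = y ^ a.val * y ^ b.val := by
  rw [← pow_add, ZMod.val_add, ← pow_eq_pow_mod _ hy]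

namespace Taft

variable {K : Type u} [Field K] {m : ℕ} {q : K} (hm : 2 ≤ m) (hq : IsPrimitiveRoot q m)

theorem x_mul_h_pow (a : ℕ) : x hm hq * h hm hq ^ a = q ^ a • (h hm hq ^ a * x hm hq) :=
  mul_pow_of_qcomm (x_mul_h hm hq) a

/-- The summands `x ⊗ h` and `1 ⊗ x` of `Δ x` q-commute, so the q-binomial theorem expands `(Δ x) ^
b`. All later coefficient comparisons rest on this formula. -/
theorem comul_h_pow_mul_x_pow (a b : ℕ) :
    Coalgebra.comul (R := K) (h hm hq ^ a * x hm hq ^ b) =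
      ∑ c ∈ Finset.range (b + 1), gaussBinom q b c •
        ((h hm hq ^ a * x hm hq ^ c) ⊗ₜ[K] (h hm hq ^ (a + c) * x hm hq ^ (b - c))) := by
  have hab : (1 ⊗ₜ[K] x hm hq) * (x hm hq ⊗ₜ[K] h hm hq) =
      q • ((x hm hq ⊗ₜ[K] h hm hq) * (1 ⊗ₜ[K] x hm hq)) := by
    rw [Algebra.TensorProduct.tmul_mul_tmul, Algebra.TensorProduct.tmul_mul_tmul, x_mul_h,
      one_mul, mul_one, TensorProduct.tmul_smul]
  rw [Bialgebra.comul_mul, Bialgebra.comul_pow, Bialgebra.comul_pow, comul_h, comul_x,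
    add_pow_of_qcomm hab, Finset.mul_sum]
  refine Finset.sum_congr rfl fun c _ => ?_
  rw [mul_smul_comm]
  simp only [Algebra.TensorProduct.tmul_pow, Algebra.TensorProduct.tmul_mul_tmul, one_pow, mul_one,
    pow_add, mul_assoc]

section Representation

variable (K) in
/-- The truncated polynomial algebra `K[t] / (t ^ m)`. -/
abbrev TruncPoly (m : ℕ) : Type u := AdjoinRoot (Polynomial.X ^ m : Polynomial K)

variable (m) in
/-- The action of `h` on functions `ZMod m → K[t] / (t ^ m)` by translation. -/
def translateEnd : Module.End K (ZMod m → TruncPoly K m) :=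
  LinearMap.funLeft K (TruncPoly K m) fun a => a - 1

/-- The action of `x` on functions `ZMod m → K[t] / (t ^ m)`: at the point `a`, multiplication
by `q ^ a * t`. -/
def weightEnd (m : ℕ) (q : K) : Module.End K (ZMod m → TruncPoly K m) :=
  LinearMap.pi fun a =>
    LinearMap.mulLeft K (q ^ a.val • AdjoinRoot.root (Polynomial.X ^ m : Polynomial K)) ∘ₗ
      LinearMap.proj a

theorem translateEnd_pow_apply (k : ℕ) (f : ZMod m → TruncPoly K m) (a : ZMod m) :
    (translateEnd m ^ k) f a = f (a - k) := by
  induction k generalizing a with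
  | zero => simp
  | succ k ih =>
    rw [pow_succ', Module.End.mul_apply, translateEnd, LinearMap.funLeft_apply, ← translateEnd, ih]
    congr 1
    push_cast
    ring

theorem weightEnd_pow_apply (k : ℕ) (f : ZMod m → TruncPoly K m) (a : ZMod m) :
    (weightEnd m q ^ k) f a =
      (q ^ a.val • AdjoinRoot.root (Polynomial.X ^ m : Polynomial K)) ^ k * f a := by
  induction k with
  | zero => simp
  | succ k ih =>
    rw [pow_succ', Module.End.mul_apply, pow_succ', mul_assoc, ← ih]
    simp [weightEnd]

theorem root_pow_eq_zero : AdjoinRoot.root (Polynomial.X ^ m : Polynomial K) ^ m = 0 := by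
  rw [← AdjoinRoot.mk_X, ← map_pow, AdjoinRoot.mk_self]

variable [NeZero m]

/-- The representation of the Taft algebra on functions `ZMod m → K[t] / (t ^ m)`. -/
def rep : Taft hm hq →ₐ[K] Module.End K (ZMod m → TruncPoly K m) :=
  lift hm hq (translateEnd m) (weightEnd m q)
    (by
      refine LinearMap.ext fun f => funext fun a => ?_
      rw [translateEnd_pow_apply]
      simp)
    (by
      refine LinearMap.ext fun f => funext fun a => ?_
      rw [weightEnd_pow_apply, smul_pow, root_pow_eq_zero]
      simp)
    (by
      refine LinearMap.ext fun f => funext fun a => ?_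
      -- The relation `x h = q h x` compares the weights at `a` and `a - 1`; the wrap-around of the
      -- representative from `m - 1` to `0` is harmless because `q ^ m = 1`.
      have hval := pow_zmodVal_add hq.pow_eq_one 1 (a - 1)
      have : Fact (1 < m) := ⟨by omega⟩
      rw [add_sub_cancel, ZMod.val_one, pow_one] at hval
      simp [weightEnd, translateEnd, hval, mul_smul])

/-- Applied to the indicator of `0`, where the weight is `q ^ 0 = 1`, `x ^ b` produces `t ^ b` and
`h ^ a` moves it to the point `a`. Distinct monomials thus become visibly independent functions. -/
theorem rep_h_pow_mul_x_pow_apply (a : ZMod m) (b : ℕ) (c : ZMod m) :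
    rep hm hq (h hm hq ^ a.val * x hm hq ^ b) (Pi.single 0 1) c =
      if a = c then AdjoinRoot.root (Polynomial.X ^ m : Polynomial K) ^ b else 0 := by
  have h1 : rep hm hq (h hm hq) = translateEnd m := lift_h ..
  have h2 : rep hm hq (x hm hq) = weightEnd m q := lift_x ..
  rw [map_mul, map_pow, map_pow, h1, h2, Module.End.mul_apply, translateEnd_pow_apply,
    weightEnd_pow_apply, ZMod.natCast_zmod_val]
  by_cases hc : a = c
  · subst hc
    simp
  · rw [Pi.single_eq_of_ne (sub_ne_zero.2 (Ne.symm hc)), mul_zero, if_neg hc]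

end Representation

variable [NeZero m]

theorem linearIndependent_h_pow_mul_x_pow :
    LinearIndependent K fun p : ZMod m × Fin m => h hm hq ^ p.1.val * x hm hq ^ (p.2 : ℕ) := by
  rw [Fintype.linearIndependent_iff]
  rintro f hf ⟨a, b⟩
  have h0 := congrArg (fun t => rep hm hq t (Pi.single 0 1) a) hf
  simp only [map_sum, map_smul, LinearMap.sum_apply, Finset.sum_apply, LinearMap.smul_apply,
    Pi.smul_apply, rep_h_pow_mul_x_pow_apply, map_zero, LinearMap.zero_apply, Pi.zero_apply,
    Fintype.sum_prod_type, smul_ite, smul_zero] at h0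
  rw [Finset.sum_comm] at h0
  simp only [Finset.sum_ite_eq', Finset.mem_univ, if_true] at h0
  -- The value at the point `a` is the class of a polynomial of degree below `m` with coefficients
  -- `f (a, ·)`; divisibility by `X ^ m` kills all of them.
  have h1 : AdjoinRoot.mk (Polynomial.X ^ m : Polynomial K)
      (∑ c : Fin m, Polynomial.C (f (a, c)) * Polynomial.X ^ (c : ℕ)) = 0 := by
    rw [← h0, map_sum]
    refine Finset.sum_congr rfl fun c _ => ?_
    rw [map_mul, map_pow, AdjoinRoot.mk_X, AdjoinRoot.mk_C, Algebra.smul_def]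
    rfl
  rw [AdjoinRoot.mk_eq_zero, Polynomial.X_pow_dvd_iff] at h1
  have h2 := h1 b b.2
  simpa [Polynomial.finsetSum_coeff, Polynomial.coeff_X_pow, Fin.val_inj] using h2

omit [NeZero m] in
theorem h_pow_mul_x_pow_mem_span (a b : ℕ) :
    h hm hq ^ a * x hm hq ^ b ∈ Submodule.span K
      (Set.range fun p : ZMod m × Fin m => h hm hq ^ p.1.val * x hm hq ^ (p.2 : ℕ)) := by
  rcases lt_or_ge b m with hb | hb
  · refine Submodule.subset_span ⟨((a : ZMod m), ⟨b, hb⟩), ?_⟩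
    simp only [ZMod.val_natCast]
    rw [← pow_eq_pow_mod _ (h_pow hm hq)]
  · rw [pow_eq_zero_of_le hb (x_pow hm hq), mul_zero]
    exact zero_mem _

-- The span contains `1` and is stable under left multiplication by both generators, hence by the
-- whole algebra.
omit [NeZero m] in
theorem span_h_pow_mul_x_pow :
    Submodule.span K
      (Set.range fun p : ZMod m × Fin m => h hm hq ^ p.1.val * x hm hq ^ (p.2 : ℕ)) = ⊤ := by
  set S := Submodule.span K
    (Set.range fun p : ZMod m × Fin m => h hm hq ^ p.1.val * x hm hq ^ (p.2 : ℕ)) with hS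
  have key : ∀ y : Taft hm hq, (∀ a b : ℕ, y * (h hm hq ^ a * x hm hq ^ b) ∈ S) →
      S ≤ S.comap (LinearMap.mulLeft K y) := by
    intro y hy
    rw [hS, Submodule.span_le]
    rintro _ ⟨p, rfl⟩
    exact hy _ _
  have hall : ∀ y : Taft hm hq, S ≤ S.comap (LinearMap.mulLeft K y) := by
    intro y
    induction y using induction with
    | h_alg r =>
      intro s hs
      rw [Submodule.mem_comap, LinearMap.mulLeft_apply, ← Algebra.smul_def]
      exact S.smul_mem r hs
    | h_h =>
      refine key _ fun a b => ?_
      rw [← mul_assoc, ← pow_succ']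
      exact h_pow_mul_x_pow_mem_span hm hq _ _
    | h_x =>
      refine key _ fun a b => ?_
      rw [← mul_assoc, x_mul_h_pow, smul_mul_assoc, mul_assoc, ← pow_succ']
      exact S.smul_mem _ (h_pow_mul_x_pow_mem_span hm hq _ _)
    | h_mul a b ha hb =>
      intro s hs
      rw [Submodule.mem_comap, LinearMap.mulLeft_apply, mul_assoc]
      exact ha (hb hs)
    | h_add a b ha hb =>
      intro s hs
      rw [Submodule.mem_comap, LinearMap.mulLeft_apply, add_mul]
      exact S.add_mem (ha hs) (hb hs)
  refine eq_top_iff.2 fun y _ => ?_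
  have h1 : (1 : Taft hm hq) ∈ S := by
    have := h_pow_mul_x_pow_mem_span hm hq 0 0
    rwa [pow_zero, pow_zero, one_mul] at this
  have := hall y h1
  rwa [Submodule.mem_comap, LinearMap.mulLeft_apply, mul_one] at this

/-- The basis `h ^ a * x ^ b`, for `a : ZMod m` and `b < m`, of the Taft algebra. -/
def basis : Module.Basis (ZMod m × Fin m) K (Taft hm hq) :=
  Module.Basis.mk (linearIndependent_h_pow_mul_x_pow hm hq) (span_h_pow_mul_x_pow hm hq).ge

theorem basis_apply (p : ZMod m × Fin m) :
    basis hm hq p = h hm hq ^ p.1.val * x hm hq ^ (p.2 : ℕ) :=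
  Module.Basis.mk_apply ..

end Taft

/-! ### Coefficients in a Hopf algebra that factorizes through the Taft algebra and `K[G]` -/

/-- Absorption gives `(1 - q) * gaussBinom q (d + 1) 1 = 1 - q ^ (d + 1)`, nonzero below `m` by
primitivity. It is used to exclude terms of degree at least two in `x` from skew-primitive elements.
-/
theorem gaussBinom_one_ne_zero {K : Type u} [Field K] {m : ℕ} {q : K} (hq : IsPrimitiveRoot q m)
    {d : ℕ} (h : d + 1 < m) : gaussBinom q (d + 1) 1 ≠ 0 := by
  intro h0
  have h1 := gaussBinom_absorb q d 0
  rw [zero_add, h0, mul_zero, gaussBinom_zero_right, mul_one] at h1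
  exact hq.pow_ne_one_of_pos_of_lt (by omega) h (sub_eq_zero.1 h1.symm).symm

section Factorization

variable {K : Type u} [Field K] {m : ℕ} {q : K} {hm : 2 ≤ m} {hq : IsPrimitiveRoot q m}
  {G : Type} [Group G] {E : Type w} [Ring E] [Bialgebra K E]

/-- The linear map `a ⊗ y ↦ i a * j y`. -/
abbrev factorMap (i : Taft hm hq →ₐc[K] E) (j : MonoidAlgebra K G →ₐc[K] E) :
    Taft hm hq ⊗[K] MonoidAlgebra K G →ₗ[K] E :=
  LinearMap.mul' K E ∘ₗ TensorProduct.map (i : Taft hm hq →ₗ[K] E)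
    (j : MonoidAlgebra K G →ₗ[K] E)

/-- The image in `E` of an element of `G`. -/
abbrev ofGroup (j : MonoidAlgebra K G →ₐc[K] E) : G →* E :=
  (j : MonoidAlgebra K G →* E).comp (MonoidAlgebra.of K G)

variable (i : Taft hm hq →ₐc[K] E) (j : MonoidAlgebra K G →ₐc[K] E)

theorem isGroupLikeElem_ofGroup (g : G) : IsGroupLikeElem K (ofGroup j g) :=
  (MonoidAlgebra.isGroupLikeElem_single_one (R := K) (A := K) g).map j

theorem isGroupLikeElem_h : IsGroupLikeElem K (i (Taft.h hm hq)) :=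
  IsGroupLikeElem.map i ⟨Taft.counit_h hm hq, Taft.comul_h hm hq⟩

theorem comul_map_x : Coalgebra.comul (R := K) (i (Taft.x hm hq)) =
    i (Taft.x hm hq) ⊗ₜ[K] i (Taft.h hm hq) + 1 ⊗ₜ[K] i (Taft.x hm hq) := by
  rw [← CoalgHomClass.map_comp_comul_apply, Taft.comul_x]
  simp

/-- The element `h ^ a * x ^ b * g` of `E`. -/
def monomial (a : ZMod m) (b : ℕ) (g : G) : E :=
  i (Taft.h hm hq ^ a.val * Taft.x hm hq ^ b) * ofGroup j g

theorem comul_monomial [NeZero m] (a : ZMod m) (b : ℕ) (g : G) :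
    Coalgebra.comul (R := K) (monomial i j a b g) =
      ∑ c ∈ Finset.range (b + 1), gaussBinom q b c •
        (monomial i j a c g ⊗ₜ[K] monomial i j (a + c) (b - c) g) := by
  rw [monomial, Bialgebra.comul_mul, (isGroupLikeElem_ofGroup j g).comul_eq_tmul_self,
    ← CoalgHomClass.map_comp_comul_apply, Taft.comul_h_pow_mul_x_pow, map_sum, Finset.sum_mul]
  refine Finset.sum_congr rfl fun c _ => ?_
  have hval : Taft.h hm hq ^ (a + c).val = Taft.h hm hq ^ (a.val + c) := by
    conv_rhs => rw [pow_eq_pow_mod _ (Taft.h_pow hm hq)]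
    rw [← ZMod.val_natCast, Nat.cast_add, ZMod.natCast_zmod_val]
  rw [map_smul, smul_mul_assoc, TensorProduct.map_tmul, Algebra.TensorProduct.tmul_mul_tmul,
    monomial, monomial, hval]
  rfl

variable [NeZero m] (hb : Function.Bijective (factorMap i j))

/-- The basis of `E` formed by the elements `h ^ a * x ^ b * g` with `b < m`. -/
def factorBasis : Module.Basis ((ZMod m × Fin m) × G) K E :=
  ((Taft.basis hm hq).tensorProduct (MonoidAlgebra.basis G K)).map (LinearEquiv.ofBijective _ hb)

theorem factorBasis_apply (p : (ZMod m × Fin m) × G) :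
    factorBasis i j hb p = monomial i j p.1.1 p.1.2 p.2 := by
  simp [factorBasis, monomial, Module.Basis.tensorProduct_apply', Taft.basis_apply, factorMap]

/-- The coefficient at `h ^ a * x ^ b * g`, which is zero when `m ≤ b`. -/
def coeff (a : ZMod m) (b : ℕ) (g : G) : E →ₗ[K] K :=
  if h : b < m then (factorBasis i j hb).coord ((a, ⟨b, h⟩), g) else 0

theorem coeff_of_le (a : ZMod m) {b : ℕ} (h : m ≤ b) (g : G) : coeff i j hb a b g = 0 :=
  dif_neg h.not_gt

open Classical in
theorem coeff_monomial (a a' : ZMod m) (b b' : ℕ) (g g' : G) (h : b < m) :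
    coeff i j hb a b g (monomial i j a' b' g') = if a = a' ∧ b = b' ∧ g = g' then 1 else 0 := by
  rcases lt_or_ge b' m with h' | h'
  · rw [coeff, dif_pos h, ← factorBasis_apply i j hb ((a', ⟨b', h'⟩), g'), Module.Basis.coord_apply,
      Module.Basis.repr_self, Finsupp.single_apply]
    refine if_congr ?_ rfl rfl
    simp only [Prod.mk.injEq, Fin.mk.injEq, and_assoc, eq_comm]
  · have h0 : monomial i j a' b' g' = 0 := by
      rw [monomial, pow_eq_zero_of_le h' (Taft.x_pow hm hq), mul_zero, map_zero, zero_mul]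
    rw [h0, map_zero, if_neg]
    rintro ⟨-, h1, -⟩
    omega

theorem ext_coeff {y z : E} (h : ∀ a, ∀ b < m, ∀ g, coeff i j hb a b g y = coeff i j hb a b g z) :
    y = z := by
  refine (factorBasis i j hb).ext_elem fun p => ?_
  have := h p.1.1 p.1.2 p.1.2.2 p.2
  rwa [coeff, dif_pos p.1.2.2] at this

/-- The tensor product of two coefficient functionals. -/
def coeffTensor (a : ZMod m) (b : ℕ) (g : G) (a' : ZMod m) (b' : ℕ) (g' : G) : E ⊗[K] E →ₗ[K] K :=
  LinearMap.mul' K K ∘ₗ TensorProduct.map (coeff i j hb a b g) (coeff i j hb a' b' g')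

theorem coeffTensor_tmul (a : ZMod m) (b : ℕ) (g : G) (a' : ZMod m) (b' : ℕ) (g' : G) (y z : E) :
    coeffTensor i j hb a b g a' b' g' (y ⊗ₜ z) = coeff i j hb a b g y * coeff i j hb a' b' g' z := by
  simp [coeffTensor]

-- This is the transpose of `comul_monomial`: a basis element contributes to the given pair of
-- monomials only through the summand `c = b`, which forces `g = g'`, `a' = a + b` and total degree
-- `b + b'`. If `b + b' ≥ m`, both sides vanish by the default value of `coeff`. Equations for `Δ y`
-- thereby become scalar equations.
open Classical in
theorem coeffTensor_comul (a : ZMod m) (b : ℕ) (g : G) (a' : ZMod m) (b' : ℕ) (g' : G)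
    (h : b < m) (h' : b' < m) (y : E) :
    coeffTensor i j hb a b g a' b' g' (Coalgebra.comul y) =
      if g = g' ∧ a' = a + b then gaussBinom q (b + b') b * coeff i j hb a (b + b') g y else 0 := by
  suffices H : coeffTensor i j hb a b g a' b' g' ∘ₗ Coalgebra.comul =
      if g = g' ∧ a' = a + b then gaussBinom q (b + b') b • coeff i j hb a (b + b') g else 0 by
    have := LinearMap.congr_fun H y
    rw [LinearMap.comp_apply] at this
    rw [this]
    split_ifs <;> simp
  refine (factorBasis i j hb).ext fun p => ?_
  obtain ⟨⟨a₀, b₀⟩, g₀⟩ := p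
  rw [factorBasis_apply, LinearMap.comp_apply, comul_monomial, map_sum]
  simp only [map_smul, coeffTensor_tmul, coeff_monomial _ _ _ _ _ _ _ _ _ h,
    coeff_monomial _ _ _ _ _ _ _ _ _ h', smul_eq_mul]
  rw [Finset.sum_eq_single b]
  · by_cases hc : a = a₀ ∧ g = g₀ ∧ b + b' = b₀
    · obtain ⟨rfl, rfl, hc⟩ := hc
      have h1 : b' = (b₀ : ℕ) - b := by omega
      have h2 : (b₀ : ℕ) = b + b' := hc.symm
      by_cases hd : g = g' ∧ a' = a + b
      · rw [if_pos hd, LinearMap.smul_apply, h2, coeff_monomial _ _ _ _ _ _ _ _ _ (h2 ▸ b₀.2)]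
        simp [hd.1.symm, hd.2]
      · rw [if_neg hd, if_neg (fun hh : a' = a + b ∧ _ => hd ⟨hh.2.2.symm, hh.1⟩)]
        simp
    · have hr : (if g = g' ∧ a' = a + b then gaussBinom q (b + b') b • coeff i j hb a (b + b') g
          else 0) (monomial i j a₀ b₀ g₀) = 0 := by
        split_ifs with hd
        · rcases lt_or_ge (b + b') m with hl | hl
          · rw [LinearMap.smul_apply, coeff_monomial _ _ _ _ _ _ _ _ _ hl, if_neg, smul_zero]
            rintro ⟨h1, h2, h3⟩
            exact hc ⟨h1, h3, h2⟩
          · rw [coeff_of_le _ _ _ _ hl, smul_zero, LinearMap.zero_apply]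
        · rfl
      rw [hr]
      by_cases hg : a = a₀ ∧ g = g₀
      · have hlt : ¬ b + b' = b₀ := fun hh => hc ⟨hg.1, hg.2, hh⟩
        by_cases hle : b ≤ b₀
        · rw [if_neg (fun hh : a' = a₀ + b ∧ b' = b₀ - b ∧ g' = g₀ => by omega)]
          simp
        · rw [gaussBinom_eq_zero_of_lt _ _ _ (not_le.1 hle), zero_mul]
      · rw [if_neg (fun hh : a = a₀ ∧ b = b ∧ g = g₀ => hg ⟨hh.1, hh.2.2⟩)]
        simp
  · intro c _ hc
    rw [if_neg (fun hh : a = a₀ ∧ b = c ∧ g = g₀ => hc hh.2.1.symm)]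
    simp
  · intro hn
    rw [Finset.mem_range] at hn
    rw [gaussBinom_eq_zero_of_lt _ _ _ (by omega), zero_mul]

-- For group-like `y` the scalar equations read as products of coefficients. A coefficient with `0 <
-- b < m` squares to zero, since `a ≠ a + b`; those with `b = 0` are orthogonal idempotents, so
-- exactly one of them is `1`.
include hb in
theorem exists_monomial_eq_of_isGroupLikeElem {y : E} (hy : IsGroupLikeElem K y) :
    ∃ a g, y = monomial i j a 0 g := by
  classical
  have hmul : ∀ a : ZMod m, ∀ b < m, ∀ (g : G) (a' : ZMod m), ∀ b' < m, ∀ g',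
      coeff i j hb a b g y * coeff i j hb a' b' g' y =
      if g = g' ∧ a' = a + b then gaussBinom q (b + b') b * coeff i j hb a (b + b') g y else 0 := by
    intro a b h g a' b' h' g'
    rw [← coeffTensor_comul i j hb a b g a' b' g' h h', hy.comul_eq_tmul_self, coeffTensor_tmul]
  have hzero : ∀ a, ∀ b < m, ∀ g, coeff i j hb a b g y ≠ 0 → b = 0 := by
    intro a b h g hne
    by_contra h0
    have h1 := hmul a b h g a b h g
    rw [if_neg] at h1
    · exact hne (mul_self_eq_zero.1 h1)
    · rintro ⟨-, h2⟩
      have h3 : ((b : ℕ) : ZMod m) = 0 := by simpa using h2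
      rw [ZMod.natCast_eq_zero_iff] at h3
      exact h0 (Nat.eq_zero_of_dvd_of_lt h3 h)
  obtain ⟨a, b, h, g, hne⟩ : ∃ a, ∃ b < m, ∃ g, coeff i j hb a b g y ≠ 0 := by
    by_contra! hc
    exact hy.ne_zero (ext_coeff i j hb fun a b h g => by rw [hc a b h g, map_zero])
  obtain rfl := hzero a b h g hne
  refine ⟨a, g, ext_coeff i j hb fun a' b' h' g' => ?_⟩
  rw [coeff_monomial _ _ _ _ _ _ _ _ _ h']
  have h1 := hmul a 0 h g a' b' h' g'
  split_ifs with hc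
  · obtain ⟨rfl, rfl, rfl⟩ := hc
    rw [if_pos ⟨rfl, by simp⟩, gaussBinom_zero_right, one_mul] at h1
    exact mul_left_cancel₀ hne (h1.trans (mul_one _).symm)
  · by_contra hne'
    obtain rfl := hzero a' b' h' g' hne'
    rw [if_neg] at h1
    · exact (mul_ne_zero hne hne') h1
    · rintro ⟨rfl, h2⟩
      exact hc ⟨by simpa using h2, rfl, rfl⟩

omit [NeZero m] in
theorem monomial_zero_zero_one : monomial i j 0 0 1 = 1 := by
  rw [monomial, map_one (ofGroup j)]
  simp

omit [NeZero m] in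
theorem monomial_zero_one_one : monomial i j 0 1 1 = i (Taft.x hm hq) := by
  rw [monomial, map_one (ofGroup j)]
  simp

omit [NeZero m] in
theorem monomial_one_zero_one : monomial i j 1 0 1 = i (Taft.h hm hq) := by
  have : Fact (1 < m) := ⟨by omega⟩
  rw [monomial, map_one (ofGroup j)]
  simp [ZMod.val_one]

include hb in
/-- The skew-primitive elements of `E`. -/
theorem skewPrimitive_eq {y k : E} (hk : IsGroupLikeElem K k)
    (hy : Coalgebra.comul (R := K) y = y ⊗ₜ[K] k + 1 ⊗ₜ[K] y) :
    ∃ β γ : K, y = β • (1 - k) + γ • i (Taft.x hm hq) ∧ (γ = 0 ∨ k = i (Taft.h hm hq)) := by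
  classical
  obtain ⟨a₀, g₀, rfl⟩ := exists_monomial_eq_of_isGroupLikeElem i j hb hk
  have hmul : ∀ a : ZMod m, ∀ b < m, ∀ (g : G) (a' : ZMod m), ∀ b' < m, ∀ g',
      (if g = g' ∧ a' = a + b then gaussBinom q (b + b') b * coeff i j hb a (b + b') g y else 0) =
      coeff i j hb a b g y * (if a' = a₀ ∧ b' = 0 ∧ g' = g₀ then 1 else 0) +
        (if a = 0 ∧ b = 0 ∧ g = 1 then 1 else 0) * coeff i j hb a' b' g' y := by
    intro a b h g a' b' h' g'
    rw [← coeffTensor_comul i j hb a b g a' b' g' h h', hy, map_add, coeffTensor_tmul,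
      coeffTensor_tmul, ← monomial_zero_zero_one i j, coeff_monomial _ _ _ _ _ _ _ _ _ h,
      coeff_monomial _ _ _ _ _ _ _ _ _ h']
  have h0m : 0 < m := by omega
  have h1m : 1 < m := by omega
  -- Compare the terms with `x` in degree `1` on the left and `b - 1 ≥ 1` on the right: `y ⊗ k + 1 ⊗
  -- y` has none, as `1` and `k` have degree zero in `x`.
  have hhigh : ∀ a, ∀ b < m, 2 ≤ b → ∀ g, coeff i j hb a b g y = 0 := by
    intro a b h h2 g
    obtain ⟨d, rfl⟩ : ∃ d, b = d + 2 := ⟨b - 2, by omega⟩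
    have h3 := hmul a 1 h1m g (a + 1) (d + 1) (by omega) g
    rw [if_pos ⟨rfl, by simp⟩, if_neg (by simp), if_neg (by simp), mul_zero, zero_mul, add_zero,
      show 1 + (d + 1) = (d + 1) + 1 by ring] at h3
    exact (mul_eq_zero.1 h3).resolve_left (gaussBinom_one_ne_zero hq (by omega))
  have hone : ∀ a g, ¬ (a = 0 ∧ g = 1) → coeff i j hb a 1 g y = 0 := by
    intro a g hn
    have h3 := hmul a 0 h0m g a 1 h1m g
    rw [if_pos ⟨rfl, by simp⟩, if_neg (by simp), if_neg (by tauto), gaussBinom_zero_right] at h3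
    simpa using h3
  have hoff : ∀ a g, ¬ (a = 0 ∧ g = 1) → ¬ (a = a₀ ∧ g = g₀) → coeff i j hb a 0 g y = 0 := by
    intro a g hn hn'
    have h3 := hmul a 0 h0m g a 0 h0m g
    rw [if_pos ⟨rfl, by simp⟩, if_neg (by tauto), if_neg (by tauto), gaussBinom_zero_right] at h3
    simpa using h3
  -- The coefficient of `1 ⊗ k` is zero in `Δ y` when `k ≠ 1`, and is the sum of the coefficients of
  -- `y` at `1` and at `k` on the other side.
  have hsum : ¬ (a₀ = 0 ∧ g₀ = 1) → coeff i j hb a₀ 0 g₀ y = - coeff i j hb 0 0 1 y := by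
    intro hn
    have h3 := hmul 0 0 h0m 1 a₀ 0 h0m g₀
    rw [if_neg, if_pos ⟨rfl, rfl, rfl⟩, if_pos ⟨rfl, rfl, rfl⟩] at h3
    · linear_combination -h3
    · rintro ⟨h4, h5⟩
      exact hn ⟨by simpa using h5, h4.symm⟩
  -- For `k = 1` the coefficient `c` of `1 ⊗ 1` satisfies `c = c + c`.
  have htriv : a₀ = 0 ∧ g₀ = 1 → coeff i j hb 0 0 1 y = 0 := by
    rintro ⟨rfl, rfl⟩
    have h3 := hmul 0 0 h0m 1 0 0 h0m 1
    simp only [gaussBinom_zero_right] at h3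
    simpa using h3
  refine ⟨coeff i j hb 0 0 1 y, coeff i j hb 0 1 1 y, ext_coeff i j hb fun a b h g => ?_, ?_⟩
  · rw [map_add, map_smul, map_smul, map_sub, ← monomial_zero_zero_one i j,
      ← monomial_zero_one_one i j, coeff_monomial _ _ _ _ _ _ _ _ _ h,
      coeff_monomial _ _ _ _ _ _ _ _ _ h, coeff_monomial _ _ _ _ _ _ _ _ _ h, smul_eq_mul,
      smul_eq_mul]
    rcases lt_trichotomy b 1 with hb1 | rfl | hb1
    · obtain rfl : b = 0 := by omega
      by_cases c1 : a = 0 ∧ g = 1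
      · obtain ⟨rfl, rfl⟩ := c1
        by_cases c2 : a₀ = 0 ∧ g₀ = 1
        · simp [htriv c2]
        · rw [if_pos ⟨rfl, rfl, rfl⟩, if_neg (fun hh => c2 ⟨hh.1.symm, hh.2.2.symm⟩),
            if_neg (by simp)]
          ring
      · by_cases c2 : a = a₀ ∧ g = g₀
        · obtain ⟨rfl, rfl⟩ := c2
          rw [hsum c1, if_neg (by tauto), if_pos ⟨rfl, rfl, rfl⟩, if_neg (by simp)]
          ring
        · rw [hoff a g c1 c2, if_neg (by tauto), if_neg (by tauto), if_neg (by simp)]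
          ring
    · by_cases c1 : a = 0 ∧ g = 1
      · obtain ⟨rfl, rfl⟩ := c1
        simp
      · rw [hone a g c1, if_neg (by simp), if_neg (by simp), if_neg (by tauto)]
        ring
    · rw [hhigh a b h (by omega) g, if_neg (by omega), if_neg (by omega), if_neg (by omega)]
      ring
  · rw [or_iff_not_imp_left]
    intro hne
    -- This is the coefficient of `x ⊗ h`: it equals `γ` in `Δ y`, and on the other side it can only
    -- come from `y ⊗ k` with `k = h`.
    have h3 := hmul 0 1 h1m 1 1 0 h0m 1
    rw [if_pos ⟨rfl, by simp⟩, if_neg (by simp : ¬ ((0 : ZMod m) = 0 ∧ 1 = 0 ∧ (1 : G) = 1)),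
      zero_mul, add_zero] at h3
    by_cases hc : (1 : ZMod m) = a₀ ∧ 0 = 0 ∧ (1 : G) = g₀
    · obtain ⟨rfl, -, rfl⟩ := hc
      exact monomial_one_zero_one i j
    · rw [if_neg hc, mul_zero, add_zero] at h3
      refine absurd ((mul_eq_zero.1 h3).resolve_left ?_) hne
      simp [gaussBinom]

end Factorization

/-! ### The character of a factorization -/

section Character

variable {K : Type u} [Field K] {m : ℕ} {q : K} {hm : 2 ≤ m} {hq : IsPrimitiveRoot q m}
  {G : Type} [Group G] {E : Type w} [Ring E] [Bialgebra K E]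

/-- In `E`, the group `G` commutes with `h` and acts on `x` through the character `χ`. -/
structure HasCharacter (i : Taft hm hq →ₐc[K] E) (j : MonoidAlgebra K G →ₐc[K] E) (χ : G →* K) :
    Prop where
  mul_h : ∀ g, ofGroup j g * i (Taft.h hm hq) = i (Taft.h hm hq) * ofGroup j g
  mul_x : ∀ g, ofGroup j g * i (Taft.x hm hq) = χ g • (i (Taft.x hm hq) * ofGroup j g)

variable {i : Taft hm hq →ₐc[K] E} {j : MonoidAlgebra K G →ₐc[K] E} [NeZero m]
  (hb : Function.Bijective (factorMap i j))

include hb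

theorem monomial_zero_injective {a a' : ZMod m} {g g' : G}
    (h : monomial i j a 0 g = monomial i j a' 0 g') : a = a' ∧ g = g' := by
  classical
  have h1 := congrArg (coeff i j hb a 0 g) h
  rw [coeff_monomial _ _ _ _ _ _ _ _ _ (by omega), coeff_monomial _ _ _ _ _ _ _ _ _ (by omega),
    if_pos ⟨rfl, rfl, rfl⟩] at h1
  by_contra hn
  rw [if_neg (by tauto)] at h1
  exact one_ne_zero h1

theorem map_h_ne_one : i (Taft.h hm hq) ≠ 1 := by
  intro h
  rw [← monomial_zero_zero_one i j, ← monomial_one_zero_one i j] at h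
  have : Fact (1 < m) := ⟨by omega⟩
  exact one_ne_zero (monomial_zero_injective hb h).1

theorem map_x_ne_smul (β : K) : i (Taft.x hm hq) ≠ β • (1 - i (Taft.h hm hq)) := by
  classical
  intro h
  rw [← monomial_zero_zero_one i j, ← monomial_one_zero_one i j, ← monomial_zero_one_one i j] at h
  have h1 := congrArg (coeff i j hb 0 1 1) h
  rw [map_smul, map_sub, coeff_monomial _ _ _ _ _ _ _ _ _ (by omega),
    coeff_monomial _ _ _ _ _ _ _ _ _ (by omega),
    coeff_monomial _ _ _ _ _ _ _ _ _ (by omega)] at h1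
  simp at h1

theorem map_x_ne_zero : i (Taft.x hm hq) ≠ 0 := by
  simpa using map_x_ne_smul hb 0

/-- A nontrivial skew-primitive element that `q`-commutes with its group-like element is a multiple
of `x`, and the group-like element is `h`. -/
theorem eq_smul_map_x_of_skewPrimitive {y k : E} (hk : IsGroupLikeElem K k)
    (hy : Coalgebra.comul (R := K) y = y ⊗ₜ[K] k + 1 ⊗ₜ[K] y) (hne : ∀ β : K, y ≠ β • (1 - k))
    (hc : y * k = q • (k * y)) :
    k = i (Taft.h hm hq) ∧ ∃ γ : K, y = γ • i (Taft.x hm hq) := by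
  obtain ⟨β, γ, rfl, h0 | rfl⟩ := skewPrimitive_eq i j hb hk hy
  · refine absurd ?_ (hne β)
    rw [h0, zero_smul, add_zero]
  refine ⟨rfl, γ, ?_⟩
  have hxh : i (Taft.x hm hq) * i (Taft.h hm hq) =
      q • (i (Taft.h hm hq) * i (Taft.x hm hq)) := by
    rw [← map_mul, Taft.x_mul_h, map_smul, map_mul]
  -- The `x` part satisfies the q-commutation by itself, whereas `1 - h` commutes with `h`. Since
  -- `h` is invertible, `h ≠ 1` and `q ≠ 1`, this leaves `β = 0`.
  have h1 : (β * (1 - q)) • (i (Taft.h hm hq) * (1 - i (Taft.h hm hq))) = 0 := by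
    rw [add_mul, mul_add, smul_mul_assoc, smul_mul_assoc, mul_smul_comm, mul_smul_comm, hxh,
      smul_add, smul_comm q γ, add_left_inj, sub_mul, one_mul] at hc
    rw [mul_sub, mul_one, mul_sub, mul_one, sub_smul, hc, mul_sub, mul_one, mul_comm β q, mul_smul,
      sub_self]
  have hq1 : (1 : K) - q ≠ 0 := by
    have := hq.pow_ne_one_of_pos_of_lt one_ne_zero (by omega)
    rw [pow_one] at this
    exact sub_ne_zero.2 this.symm
  have hh : i (Taft.h hm hq) * (1 - i (Taft.h hm hq)) ≠ 0 := by
    intro h2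
    have h3 : i (Taft.h hm hq ^ (m - 1)) * i (Taft.h hm hq) = 1 := by
      rw [← map_mul, Taft.h_pow_pred_mul_h, map_one]
    have h4 := congrArg (fun z => i (Taft.h hm hq ^ (m - 1)) * z) h2
    simp only [← mul_assoc, h3, one_mul, mul_zero] at h4
    exact map_h_ne_one hb (sub_eq_zero.1 h4).symm
  have hβ : β = 0 :=
    (mul_eq_zero.1 ((smul_eq_zero.1 h1).resolve_right hh)).resolve_right hq1
  rw [hβ, zero_smul, zero_add]

/-- The conjugate `g x g⁻¹` is skew-primitive for the group-like `g h g⁻¹` and q-commutes with it,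
so `eq_smul_map_x_of_skewPrimitive` identifies both. The scalars are multiplicative in `g` because
`x ≠ 0`. -/
theorem exists_hasCharacter : ∃ χ : G →* K, HasCharacter i j χ := by
  have hinv : ∀ g, ofGroup j g⁻¹ * ofGroup j g = 1 := fun g => by
    rw [← map_mul, inv_mul_cancel, map_one]
  have hinv' : ∀ g, ofGroup j g * ofGroup j g⁻¹ = 1 := fun g => by
    rw [← map_mul, mul_inv_cancel, map_one]
  have key : ∀ g, ofGroup j g * i (Taft.h hm hq) * ofGroup j g⁻¹ = i (Taft.h hm hq) ∧
      ∃ γ : K, ofGroup j g * i (Taft.x hm hq) * ofGroup j g⁻¹ = γ • i (Taft.x hm hq) := by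
    intro g
    refine eq_smul_map_x_of_skewPrimitive hb (((isGroupLikeElem_ofGroup j g).mul
      (isGroupLikeElem_h i)).mul (isGroupLikeElem_ofGroup j g⁻¹)) ?_ ?_ ?_
    · rw [Bialgebra.comul_mul, Bialgebra.comul_mul, comul_map_x,
        (isGroupLikeElem_ofGroup j g).comul_eq_tmul_self,
        (isGroupLikeElem_ofGroup j g⁻¹).comul_eq_tmul_self, mul_add, add_mul]
      simp only [Algebra.TensorProduct.tmul_mul_tmul, mul_one, hinv']
    · intro β h
      have h1 := congrArg (fun z => ofGroup j g⁻¹ * z * ofGroup j g) h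
      simp only [mul_smul_comm, smul_mul_assoc, mul_sub, sub_mul, mul_one] at h1
      simp only [← mul_assoc, hinv, one_mul] at h1
      simp only [mul_assoc, hinv, mul_one] at h1
      exact map_x_ne_smul hb β h1
    · have h1 : ∀ y z : E, ofGroup j g * y * ofGroup j g⁻¹ * (ofGroup j g * z * ofGroup j g⁻¹) =
          ofGroup j g * (y * z) * ofGroup j g⁻¹ := fun y z => by
        simp only [mul_assoc]
        rw [← mul_assoc (ofGroup j g⁻¹) (ofGroup j g), hinv, one_mul]
      rw [h1, h1, ← map_mul, Taft.x_mul_h, map_smul, map_mul, mul_smul_comm, smul_mul_assoc]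
  choose h1 γ h2 using key
  have hx : ∀ g, ofGroup j g * i (Taft.x hm hq) = γ g • (i (Taft.x hm hq) * ofGroup j g) := by
    intro g
    rw [← smul_mul_assoc, ← h2, mul_assoc _ (ofGroup j g⁻¹), hinv, mul_one]
  refine ⟨⟨⟨γ, ?_⟩, ?_⟩, ⟨fun g => ?_, hx⟩⟩
  · have h3 := hx 1
    rw [map_one, one_mul, mul_one] at h3
    refine smul_left_injective K (map_x_ne_zero hb) ?_
    simp only [one_smul, ← h3]
  · intro g g'
    have h3 : (γ (g * g')) • (i (Taft.x hm hq) * ofGroup j (g * g')) =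
        (γ g * γ g') • (i (Taft.x hm hq) * ofGroup j (g * g')) := by
      rw [← hx, map_mul, mul_assoc, hx, mul_smul_comm, ← mul_assoc, hx, smul_mul_assoc, smul_smul,
        mul_assoc, mul_comm (γ g')]
    have h4 := congrArg (fun z => z * ofGroup j (g * g')⁻¹) h3
    simp only [smul_mul_assoc, mul_assoc, hinv', mul_one] at h4
    exact smul_left_injective K (map_x_ne_zero hb) h4
  · have h3 := congrArg (fun z => z * ofGroup j g) (h1 g)
    simpa only [mul_assoc, hinv, mul_one] using h3

-- The group-like elements of `E` multiply as in `ZMod m × G`; this makes the projection to `G`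
-- multiplicative.
omit hb in
theorem HasCharacter.monomial_mul {χ : G →* K} (hχ : HasCharacter i j χ) (a a' : ZMod m)
    (g g' : G) :
    monomial i j a 0 g * monomial i j a' 0 g' = monomial i j (a + a') 0 (g * g') := by
  have hc : Commute (ofGroup j g) (i (Taft.h hm hq) ^ a'.val) :=
    Commute.pow_right (hχ.mul_h g) _
  simp only [monomial, pow_zero, mul_one, map_mul (ofGroup j),
    pow_zmodVal_add (Taft.h_pow hm hq), map_mul i]
  rw [map_pow i _ a'.val, mul_assoc, ← mul_assoc (ofGroup j g), hc.eq, mul_assoc, mul_assoc]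

/-- The characters of two factorizations of `E` agree, up to an injective endomorphism of `G` and
up to `m`-th roots of unity. -/
theorem HasCharacter.exists_pow_eq {χ χ' : G →* K} (hχ : HasCharacter i j χ)
    {i' : Taft hm hq →ₐc[K] E} {j' : MonoidAlgebra K G →ₐc[K] E}
    (hb' : Function.Bijective (factorMap i' j')) (hχ' : HasCharacter i' j' χ') :
    ∃ v : G →* G, Function.Injective v ∧ ∀ g, χ' g ^ m = χ (v g) ^ m := by
  classical
  -- Both factorizations share the same `h`, and the same `x` up to a nonzero scalar.
  obtain ⟨hh, γ, hγ⟩ := eq_smul_map_x_of_skewPrimitive hb (isGroupLikeElem_h i') (comul_map_x i')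
    (map_x_ne_smul hb') (by rw [← map_mul, Taft.x_mul_h, map_smul, map_mul])
  have hγ0 : γ ≠ 0 := by
    rintro rfl
    exact map_x_ne_zero hb' (by rw [hγ, zero_smul])
  choose a v hav using fun g =>
    exists_monomial_eq_of_isGroupLikeElem i j hb (isGroupLikeElem_ofGroup j' g)
  have hmon : ∀ c, monomial i' j' c 0 1 = monomial i j c 0 1 := by
    intro c
    simp only [monomial, pow_zero, mul_one, map_one (ofGroup j), map_one (ofGroup j'), map_pow, hh]
  have hone : monomial i j (a 1) 0 (v 1) = monomial i j 0 0 1 := by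
    rw [← hav, map_one, monomial_zero_zero_one]
  have hmul : ∀ g g', monomial i j (a (g * g')) 0 (v (g * g')) =
      monomial i j (a g + a g') 0 (v g * v g') := by
    intro g g'
    rw [← hav, map_mul, hav, hav, hχ.monomial_mul]
  refine ⟨⟨⟨v, (monomial_zero_injective hb hone).2⟩,
    fun g g' => (monomial_zero_injective hb (hmul g g')).2⟩, ?_, fun g => ?_⟩
  · rw [injective_iff_map_eq_one]
    intro g hg
    have hg' : v g = 1 := hg
    -- If `v g = 1`, then the image of `g` is a power of the common `h`, which the second
    -- factorization allows only for `g = 1`.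
    have h1 : monomial i' j' 0 0 g = monomial i' j' (a g) 0 1 := by
      rw [hmon, ← hg', ← hav]
      simp [monomial]
    exact (monomial_zero_injective hb' h1).2
  · have h1 := hχ'.mul_x g
    rw [hγ, mul_smul_comm, smul_mul_assoc, smul_comm _ γ] at h1
    replace h1 := smul_right_injective E hγ0 h1
    -- Moving `x` across `h ^ a(g) * v(g)` costs `χ(v g)` from the group part and `q ^ a(g)` from
    -- the power of `h`, so `χ(v g) = χ'(g) q ^ a(g)`. Taking `m`-th powers removes the root of
    -- unity.
    have h2 : monomial i j (a g) 0 (v g) * i (Taft.x hm hq) =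
        χ (v g) • monomial i j (a g) 1 (v g) := by
      rw [monomial, monomial, mul_assoc, hχ.mul_x, mul_smul_comm, ← mul_assoc, ← map_mul, pow_zero,
        mul_one, pow_one]
    have h3 : i (Taft.x hm hq) * monomial i j (a g) 0 (v g) =
        q ^ (a g).val • monomial i j (a g) 1 (v g) := by
      rw [monomial, monomial, ← mul_assoc, ← map_mul, pow_zero, mul_one, pow_one, Taft.x_mul_h_pow,
        map_smul, smul_mul_assoc]
    simp only [hav, h2, h3] at h1
    have h4 := congrArg (coeff i j hb (a g) 1 (v g)) h1
    simp only [map_smul, smul_eq_mul, coeff_monomial _ _ _ _ _ _ _ _ _ (by omega : 1 < m), and_self,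
      if_true, mul_one] at h4
    change χ' g ^ m = χ (v g) ^ m
    rw [h4, mul_pow, ← pow_mul, mul_comm _ m, pow_mul,
      hq.pow_eq_one, one_pow, mul_one]

end Character

/-! ### Antipodes on products -/

section Antipode

variable {K : Type u} [Field K] {A : Type v} [Ring A] [Bialgebra K A] {S : A →ₗ[K] A}
  (hS : ∀ a b, S (a * b) = S b * S a)

include hS

/-- For anti-multiplicative `S`, the sum for `a * b` is `∑ S(b₁) (∑ S(a₁) a₂) b₂`, whose inner sum
is a scalar. The antipode identity therefore needs checking on generators only. -/
theorem mul_rTensor_comul_mul {a b : A}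
    (ha : LinearMap.mul' K A (S.rTensor A (Coalgebra.comul a)) =
      algebraMap K A (Coalgebra.counit a))
    (hb : LinearMap.mul' K A (S.rTensor A (Coalgebra.comul b)) =
      algebraMap K A (Coalgebra.counit b)) :
    LinearMap.mul' K A (S.rTensor A (Coalgebra.comul (a * b))) =
      algebraMap K A (Coalgebra.counit (a * b)) := by
  have key : ∀ s t : A ⊗[K] A,
      LinearMap.mul' K A (S.rTensor A s) = algebraMap K A (Coalgebra.counit a) →
      LinearMap.mul' K A (S.rTensor A (s * t)) =
        Coalgebra.counit (R := K) a • LinearMap.mul' K A (S.rTensor A t) := by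
    intro s t hs
    induction t with
    | zero => simp
    | add t t' ht ht' => rw [mul_add, map_add, map_add, map_add, map_add, smul_add, ht, ht']
    | tmul c d =>
      have : ∀ s : A ⊗[K] A, LinearMap.mul' K A (S.rTensor A (s * c ⊗ₜ d)) =
          S c * LinearMap.mul' K A (S.rTensor A s) * d := by
        intro s
        induction s with
        | zero => simp
        | add s s' hs hs' => rw [add_mul, map_add, map_add, map_add, map_add, mul_add, add_mul,
            hs, hs']
        | tmul e f => simp [hS, mul_assoc]
      rw [this, hs, LinearMap.rTensor_tmul, LinearMap.mul'_apply, ← Algebra.commutes, mul_assoc,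
        Algebra.smul_def]
  rw [Bialgebra.comul_mul, key _ _ ha, hb, Bialgebra.counit_mul, map_mul, Algebra.smul_def]

theorem mul_lTensor_comul_mul {a b : A}
    (ha : LinearMap.mul' K A (S.lTensor A (Coalgebra.comul a)) =
      algebraMap K A (Coalgebra.counit a))
    (hb : LinearMap.mul' K A (S.lTensor A (Coalgebra.comul b)) =
      algebraMap K A (Coalgebra.counit b)) :
    LinearMap.mul' K A (S.lTensor A (Coalgebra.comul (a * b))) =
      algebraMap K A (Coalgebra.counit (a * b)) := by
  have key : ∀ s t : A ⊗[K] A,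
      LinearMap.mul' K A (S.lTensor A t) = algebraMap K A (Coalgebra.counit b) →
      LinearMap.mul' K A (S.lTensor A (s * t)) =
        Coalgebra.counit (R := K) b • LinearMap.mul' K A (S.lTensor A s) := by
    intro s t ht
    induction s with
    | zero => simp
    | add s s' hs hs' => rw [add_mul, map_add, map_add, map_add, map_add, smul_add, hs, hs']
    | tmul c d =>
      have : ∀ t : A ⊗[K] A, LinearMap.mul' K A (S.lTensor A (c ⊗ₜ d * t)) =
          c * LinearMap.mul' K A (S.lTensor A t) * S d := by
        intro t
        induction t with
        | zero => simp
        | add t t' ht ht' => rw [mul_add, map_add, map_add, map_add, map_add, mul_add, add_mul,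
            ht, ht']
        | tmul e f => simp [hS, mul_assoc]
      rw [this, ht, LinearMap.lTensor_tmul, LinearMap.mul'_apply, ← Algebra.commutes, mul_assoc,
        Algebra.smul_def]
  rw [Bialgebra.comul_mul, key _ _ hb, ha, Bialgebra.counit_mul, map_mul, Algebra.smul_def,
    Algebra.commutes]

end Antipode

/-! ### The smash product of the Taft algebra by a character -/

/-- Generators of the smash product of the Taft algebra with `K[G]`. -/
inductive SmashGen (G : Type) : Type
  | h : SmashGen G
  | x : SmashGen G
  | of : G → SmashGen G

/-- The relations of the Taft algebra and of the group `G`, with `g h = h g` and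
`g x = χ(g) x g`. -/
inductive SmashRel {K : Type u} [Field K] {G : Type} [Group G] (m : ℕ) (q : K) (χ : G →* K) :
    FreeAlgebra K (SmashGen G) → FreeAlgebra K (SmashGen G) → Prop
  | h_pow : SmashRel m q χ (FreeAlgebra.ι K SmashGen.h ^ m) 1
  | x_pow : SmashRel m q χ (FreeAlgebra.ι K SmashGen.x ^ m) 0
  | x_mul_h : SmashRel m q χ (FreeAlgebra.ι K SmashGen.x * FreeAlgebra.ι K SmashGen.h)
      (q • (FreeAlgebra.ι K SmashGen.h * FreeAlgebra.ι K SmashGen.x))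
  | of_one : SmashRel m q χ (FreeAlgebra.ι K (SmashGen.of 1)) 1
  | of_mul (g g' : G) : SmashRel m q χ (FreeAlgebra.ι K (SmashGen.of (g * g')))
      (FreeAlgebra.ι K (SmashGen.of g) * FreeAlgebra.ι K (SmashGen.of g'))
  | of_mul_h (g : G) : SmashRel m q χ
      (FreeAlgebra.ι K (SmashGen.of g) * FreeAlgebra.ι K SmashGen.h)
      (FreeAlgebra.ι K SmashGen.h * FreeAlgebra.ι K (SmashGen.of g))
  | of_mul_x (g : G) : SmashRel m q χ
      (FreeAlgebra.ι K (SmashGen.of g) * FreeAlgebra.ι K SmashGen.x)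
      (χ g • (FreeAlgebra.ι K SmashGen.x * FreeAlgebra.ι K (SmashGen.of g)))

/-- The algebra generated by the Taft algebra and the group `G`, where `G` commutes with `h` and
acts on `x` through the character `χ`. -/
@[nolint unusedArguments]
def Smash {K : Type u} [Field K] {m : ℕ} {q : K} (_hm : 2 ≤ m) (_hq : IsPrimitiveRoot q m)
    {G : Type} [Group G] (χ : G →* K) : Type u :=
  RingQuot (SmashRel m q χ)

namespace Smash

variable {K : Type u} [Field K] {m : ℕ} {q : K} (hm : 2 ≤ m) (hq : IsPrimitiveRoot q m)
  {G : Type} [Group G] (χ : G →* K)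

instance : Ring (Smash hm hq χ) := inferInstanceAs (Ring (RingQuot (SmashRel m q χ)))

instance : Algebra K (Smash hm hq χ) := inferInstanceAs (Algebra K (RingQuot (SmashRel m q χ)))

/-- The quotient map from the free algebra. -/
def mk : FreeAlgebra K (SmashGen G) →ₐ[K] Smash hm hq χ := RingQuot.mkAlgHom K (SmashRel m q χ)

variable {χ} in
theorem mk_rel {y z : FreeAlgebra K (SmashGen G)} (h : SmashRel m q χ y z) :
    mk hm hq χ y = mk hm hq χ z :=
  RingQuot.mkAlgHom_rel K h

/-- The inclusion of the Taft algebra. -/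
def ofTaft : Taft hm hq →ₐ[K] Smash hm hq χ :=
  Taft.lift hm hq (mk hm hq χ (FreeAlgebra.ι K SmashGen.h))
    (mk hm hq χ (FreeAlgebra.ι K SmashGen.x))
    (by rw [← map_pow, mk_rel hm hq .h_pow, map_one])
    (by rw [← map_pow, mk_rel hm hq .x_pow, map_zero])
    (by rw [← map_mul, mk_rel hm hq .x_mul_h, map_smul, map_mul])

/-- The inclusion of the group. -/
def of : G →* Smash hm hq χ where
  toFun g := mk hm hq χ (FreeAlgebra.ι K (SmashGen.of g))
  map_one' := by rw [mk_rel hm hq .of_one, map_one]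
  map_mul' g g' := by rw [mk_rel hm hq (.of_mul g g'), map_mul]

theorem ofTaft_h : ofTaft hm hq χ (Taft.h hm hq) = mk hm hq χ (FreeAlgebra.ι K SmashGen.h) :=
  Taft.lift_h ..

theorem ofTaft_x : ofTaft hm hq χ (Taft.x hm hq) = mk hm hq χ (FreeAlgebra.ι K SmashGen.x) :=
  Taft.lift_x ..

theorem of_mul_h (g : G) : of hm hq χ g * ofTaft hm hq χ (Taft.h hm hq) =
    ofTaft hm hq χ (Taft.h hm hq) * of hm hq χ g := by
  rw [ofTaft_h, of, MonoidHom.coe_mk, OneHom.coe_mk, ← map_mul, mk_rel hm hq (.of_mul_h g),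
    map_mul]

theorem of_mul_x (g : G) : of hm hq χ g * ofTaft hm hq χ (Taft.x hm hq) =
    χ g • (ofTaft hm hq χ (Taft.x hm hq) * of hm hq χ g) := by
  rw [ofTaft_x, of, MonoidHom.coe_mk, OneHom.coe_mk, ← map_mul, mk_rel hm hq (.of_mul_x g),
    map_smul, map_mul]

section Lift

variable {χ} {B : Type v} [Ring B] [Algebra K B] (f : Taft hm hq →ₐ[K] B) (w : G →* B)
  (hh : ∀ g, w g * f (Taft.h hm hq) = f (Taft.h hm hq) * w g)
  (hx : ∀ g, w g * f (Taft.x hm hq) = χ g • (f (Taft.x hm hq) * w g))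

/-- The universal property of the presentation. -/
def lift : Smash hm hq χ →ₐ[K] B :=
  RingQuot.liftAlgHom K ⟨FreeAlgebra.lift K
    (fun s => SmashGen.casesOn s (f (Taft.h hm hq)) (f (Taft.x hm hq)) w), by
    intro y z hyz
    have h1 : f (Taft.h hm hq) ^ m = 1 := by rw [← map_pow, Taft.h_pow, map_one]
    have h2 : f (Taft.x hm hq) ^ m = 0 := by rw [← map_pow, Taft.x_pow, map_zero]
    have h3 : f (Taft.x hm hq) * f (Taft.h hm hq) = q • (f (Taft.h hm hq) * f (Taft.x hm hq)) := by
      rw [← map_mul, Taft.x_mul_h, map_smul, map_mul]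
    cases hyz with
    | h_pow => simp [h1]
    | x_pow => simp [h2]
    | x_mul_h => simp [h3]
    | of_one => simp
    | of_mul g g' => simp
    | of_mul_h g => simp [hh]
    | of_mul_x g => simp [hx]⟩

theorem lift_mk (s : SmashGen G) : lift hm hq f w hh hx (mk hm hq χ (FreeAlgebra.ι K s)) =
    SmashGen.casesOn s (f (Taft.h hm hq)) (f (Taft.x hm hq)) w :=
  (RingQuot.liftAlgHom_mkAlgHom_apply K _ _ _).trans (by simp)

theorem lift_of (g : G) : lift hm hq f w hh hx (of hm hq χ g) = w g :=
  lift_mk ..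

theorem lift_ofTaft (a : Taft hm hq) : lift hm hq f w hh hx (ofTaft hm hq χ a) = f a := by
  suffices (lift hm hq f w hh hx).comp (ofTaft hm hq χ) = f from DFunLike.congr_fun this a
  apply Taft.algHom_ext
  · rw [AlgHom.comp_apply, ofTaft_h, lift_mk]
  · rw [AlgHom.comp_apply, ofTaft_x, lift_mk]

end Lift

variable {hm hq χ}

theorem algHom_ext {B : Type v} [Semiring B] [Algebra K B] {f g : Smash hm hq χ →ₐ[K] B}
    (h1 : f (ofTaft hm hq χ (Taft.h hm hq)) = g (ofTaft hm hq χ (Taft.h hm hq)))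
    (h2 : f (ofTaft hm hq χ (Taft.x hm hq)) = g (ofTaft hm hq χ (Taft.x hm hq)))
    (h3 : ∀ s, f (of hm hq χ s) = g (of hm hq χ s)) : f = g := by
  rw [ofTaft_h] at h1
  rw [ofTaft_x] at h2
  apply RingQuot.ringQuot_ext' K
  apply FreeAlgebra.hom_ext
  funext i
  cases i with
  | h => exact h1
  | x => exact h2
  | of s => exact h3 s

theorem induction {P : Smash hm hq χ → Prop} (h_alg : ∀ r : K, P (algebraMap K _ r))
    (h_h : P (ofTaft hm hq χ (Taft.h hm hq))) (h_x : P (ofTaft hm hq χ (Taft.x hm hq)))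
    (h_of : ∀ g, P (of hm hq χ g)) (h_mul : ∀ a b, P a → P b → P (a * b))
    (h_add : ∀ a b, P a → P b → P (a + b)) (a : Smash hm hq χ) : P a := by
  rw [ofTaft_h] at h_h
  rw [ofTaft_x] at h_x
  obtain ⟨a, rfl⟩ := RingQuot.mkAlgHom_surjective K (SmashRel m q χ) a
  change P (mk hm hq χ a)
  induction a using FreeAlgebra.induction with
  | grade0 r => rw [AlgHom.commutes]; exact h_alg r
  | grade1 i =>
    cases i with
    | h => exact h_h
    | x => exact h_x
    | of g => exact h_of g
  | mul a b iha ihb => rw [map_mul]; exact h_mul _ _ iha ihb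
  | add a b iha ihb => rw [map_add]; exact h_add _ _ iha ihb

variable (hm hq χ)

/-- The comultiplication. -/
def comulHom : Smash hm hq χ →ₐ[K] Smash hm hq χ ⊗[K] Smash hm hq χ :=
  lift hm hq ((Algebra.TensorProduct.map (ofTaft hm hq χ) (ofTaft hm hq χ)).comp
      (Taft.comulHom hm hq))
    { toFun := fun g => of hm hq χ g ⊗ₜ of hm hq χ g
      map_one' := by rw [map_one, Algebra.TensorProduct.one_def]
      map_mul' := fun g g' => by rw [map_mul, Algebra.TensorProduct.tmul_mul_tmul] }
    (fun g => by simp [Taft.comulHom_h, of_mul_h])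
    (fun g => by
      simp [Taft.comulHom_x, of_mul_h, of_mul_x, mul_add, add_mul, TensorProduct.smul_tmul'])

/-- The counit. -/
def counitHom : Smash hm hq χ →ₐ[K] K :=
  lift hm hq (Taft.counitHom hm hq) 1 (fun g => by simp) (fun g => by simp [Taft.counitHom_x])

theorem comulHom_h : comulHom hm hq χ (ofTaft hm hq χ (Taft.h hm hq)) =
    ofTaft hm hq χ (Taft.h hm hq) ⊗ₜ ofTaft hm hq χ (Taft.h hm hq) := by
  rw [comulHom, lift_ofTaft, AlgHom.comp_apply, Taft.comulHom_h, Algebra.TensorProduct.map_tmul]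

theorem comulHom_x : comulHom hm hq χ (ofTaft hm hq χ (Taft.x hm hq)) =
    ofTaft hm hq χ (Taft.x hm hq) ⊗ₜ ofTaft hm hq χ (Taft.h hm hq) +
      1 ⊗ₜ ofTaft hm hq χ (Taft.x hm hq) := by
  rw [comulHom, lift_ofTaft, AlgHom.comp_apply, Taft.comulHom_x, map_add,
    Algebra.TensorProduct.map_tmul, Algebra.TensorProduct.map_tmul, map_one]

theorem comulHom_of (g : G) : comulHom hm hq χ (of hm hq χ g) = of hm hq χ g ⊗ₜ of hm hq χ g :=
  lift_of ..

theorem counitHom_h : counitHom hm hq χ (ofTaft hm hq χ (Taft.h hm hq)) = 1 := by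
  rw [counitHom, lift_ofTaft, Taft.counitHom_h]

theorem counitHom_x : counitHom hm hq χ (ofTaft hm hq χ (Taft.x hm hq)) = 0 := by
  rw [counitHom, lift_ofTaft, Taft.counitHom_x]

theorem counitHom_of (g : G) : counitHom hm hq χ (of hm hq χ g) = 1 :=
  lift_of ..

instance : Bialgebra K (Smash hm hq χ) :=
  Bialgebra.ofAlgHom (comulHom hm hq χ) (counitHom hm hq χ)
    (by
      apply algHom_ext
      · simp [comulHom_h]
      · simp [comulHom_x, comulHom_h, TensorProduct.add_tmul, TensorProduct.tmul_add,
          Algebra.TensorProduct.one_def, add_assoc]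
      · simp [comulHom_of])
    (by
      apply algHom_ext
      · simp [comulHom_h, counitHom_h]
      · simp [comulHom_x, counitHom_x]
      · simp [comulHom_of, counitHom_of])
    (by
      apply algHom_ext
      · simp [comulHom_h, counitHom_h]
      · simp [comulHom_x, counitHom_x, counitHom_h]
      · simp [comulHom_of, counitHom_of])

theorem comul_h : Coalgebra.comul (R := K) (ofTaft hm hq χ (Taft.h hm hq)) =
    ofTaft hm hq χ (Taft.h hm hq) ⊗ₜ ofTaft hm hq χ (Taft.h hm hq) := comulHom_h hm hq χ

theorem comul_x : Coalgebra.comul (R := K) (ofTaft hm hq χ (Taft.x hm hq)) =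
    ofTaft hm hq χ (Taft.x hm hq) ⊗ₜ ofTaft hm hq χ (Taft.h hm hq) +
      1 ⊗ₜ ofTaft hm hq χ (Taft.x hm hq) := comulHom_x hm hq χ

theorem comul_of (g : G) :
    Coalgebra.comul (R := K) (of hm hq χ g) = of hm hq χ g ⊗ₜ of hm hq χ g := comulHom_of hm hq χ g

theorem counit_h : Coalgebra.counit (R := K) (ofTaft hm hq χ (Taft.h hm hq)) = 1 :=
  counitHom_h hm hq χ

theorem counit_x : Coalgebra.counit (R := K) (ofTaft hm hq χ (Taft.x hm hq)) = 0 :=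
  counitHom_x hm hq χ

theorem counit_of (g : G) : Coalgebra.counit (R := K) (of hm hq χ g) = 1 := counitHom_of hm hq χ g

theorem of_mul_of_inv (g : G) : of hm hq χ g * of hm hq χ g⁻¹ = 1 := by
  rw [← map_mul, mul_inv_cancel, map_one]

theorem of_inv_mul_of (g : G) : of hm hq χ g⁻¹ * of hm hq χ g = 1 := by
  rw [← map_mul, inv_mul_cancel, map_one]

theorem commute_of_h_pow (g : G) (k : ℕ) :
    Commute (of hm hq χ g) (ofTaft hm hq χ (Taft.h hm hq ^ k)) := by
  rw [map_pow]
  exact Commute.pow_right (of_mul_h hm hq χ g) k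

/-- This is the relation between `g` and `x` in the form required in the opposite algebra, where `g`
is sent to `g⁻¹`. -/
theorem x_mul_of_inv (g : G) : ofTaft hm hq χ (Taft.x hm hq) * of hm hq χ g⁻¹ =
    χ g • (of hm hq χ g⁻¹ * ofTaft hm hq χ (Taft.x hm hq)) := by
  rw [of_mul_x, smul_smul, ← map_mul, mul_inv_cancel, map_one, one_smul]

/-- The antipode as an algebra map to the opposite algebra. -/
def antipodeHom : Smash hm hq χ →ₐ[K] (Smash hm hq χ)ᵐᵒᵖ :=
  lift hm hq ((AlgHom.op (ofTaft hm hq χ)).comp (Taft.antipodeHom hm hq))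
    { toFun := fun g => MulOpposite.op (of hm hq χ g⁻¹)
      map_one' := by rw [inv_one, map_one, MulOpposite.op_one]
      map_mul' := fun g g' => by rw [mul_inv_rev, map_mul, MulOpposite.op_mul] }
    (fun g => by
      have h1 : Taft.antipodeHom hm hq (Taft.h hm hq) =
        MulOpposite.op (Taft.h hm hq ^ (m - 1)) := Taft.lift_h ..
      rw [AlgHom.comp_apply, h1]
      exact congrArg MulOpposite.op (commute_of_h_pow hm hq χ g⁻¹ (m - 1)).eq.symm)
    (fun g => by
      have h1 : Taft.antipodeHom hm hq (Taft.x hm hq) =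
        MulOpposite.op (-(Taft.x hm hq * Taft.h hm hq ^ (m - 1))) := Taft.lift_x ..
      rw [AlgHom.comp_apply, h1]
      change MulOpposite.op (ofTaft hm hq χ (-(Taft.x hm hq * Taft.h hm hq ^ (m - 1))) *
        of hm hq χ g⁻¹) = MulOpposite.op (χ g • (of hm hq χ g⁻¹ *
          ofTaft hm hq χ (-(Taft.x hm hq * Taft.h hm hq ^ (m - 1)))))
      rw [map_neg, map_mul, neg_mul, mul_assoc, ← (commute_of_h_pow hm hq χ g⁻¹ (m - 1)).eq,
        ← mul_assoc, x_mul_of_inv, mul_neg, smul_neg, smul_mul_assoc, mul_assoc])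

/-- The antipode as a linear map. -/
def antipode : Smash hm hq χ →ₗ[K] Smash hm hq χ :=
  (MulOpposite.opLinearEquiv K).symm.toLinearMap ∘ₗ (antipodeHom hm hq χ).toLinearMap

theorem antipode_algebraMap (r : K) :
    antipode hm hq χ (algebraMap K _ r) = algebraMap K _ r := by
  simp [antipode]

theorem antipode_ofTaft (a : Taft hm hq) :
    antipode hm hq χ (ofTaft hm hq χ a) = ofTaft hm hq χ (Taft.antipode hm hq a) := by
  simp [antipode, antipodeHom, lift_ofTaft, Taft.antipode]

theorem antipode_of (g : G) : antipode hm hq χ (of hm hq χ g) = of hm hq χ g⁻¹ := by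
  simp [antipode, antipodeHom, lift_of]

theorem antipode_mul (a b : Smash hm hq χ) :
    antipode hm hq χ (a * b) = antipode hm hq χ b * antipode hm hq χ a := by
  simp [antipode]

theorem antipode_one : antipode hm hq χ 1 = 1 := by
  have := antipode_algebraMap hm hq χ 1
  rwa [map_one] at this

theorem mul_antipode_rTensor_comul (a : Smash hm hq χ) :
    LinearMap.mul' K _ ((antipode hm hq χ).rTensor _ (Coalgebra.comul a)) =
      algebraMap K _ (Coalgebra.counit a) := by
  induction a using induction with
  | h_alg r =>
    rw [Bialgebra.comul_algebraMap, Bialgebra.counit_algebraMap,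
      Algebra.TensorProduct.algebraMap_apply, LinearMap.rTensor_tmul, LinearMap.mul'_apply,
      antipode_algebraMap, mul_one]
  | h_h =>
    rw [comul_h, counit_h, LinearMap.rTensor_tmul, LinearMap.mul'_apply, antipode_ofTaft,
      Taft.antipode_h, ← map_mul, Taft.h_pow_pred_mul_h, map_one, map_one]
  | h_x =>
    rw [comul_x, counit_x, map_add, LinearMap.rTensor_tmul, LinearMap.rTensor_tmul, map_add,
      LinearMap.mul'_apply, LinearMap.mul'_apply, antipode_ofTaft, Taft.antipode_x, ← map_mul,
      neg_mul, mul_assoc, Taft.h_pow_pred_mul_h, mul_one, map_neg, antipode_one, one_mul, map_zero,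
      neg_add_cancel]
  | h_of g =>
    rw [comul_of, counit_of, LinearMap.rTensor_tmul, LinearMap.mul'_apply, antipode_of,
      of_inv_mul_of, map_one]
  | h_mul a b ha hb => exact mul_rTensor_comul_mul (antipode_mul hm hq χ) ha hb
  | h_add a b ha hb => simp only [map_add, ha, hb]

theorem mul_antipode_lTensor_comul (a : Smash hm hq χ) :
    LinearMap.mul' K _ ((antipode hm hq χ).lTensor _ (Coalgebra.comul a)) =
      algebraMap K _ (Coalgebra.counit a) := by
  induction a using induction with
  | h_alg r =>
    rw [Bialgebra.comul_algebraMap, Bialgebra.counit_algebraMap,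
      Algebra.TensorProduct.algebraMap_apply, LinearMap.lTensor_tmul, LinearMap.mul'_apply,
      antipode_one, mul_one]
  | h_h =>
    rw [comul_h, counit_h, LinearMap.lTensor_tmul, LinearMap.mul'_apply, antipode_ofTaft,
      Taft.antipode_h, ← map_mul, Taft.h_mul_h_pow_pred, map_one, map_one]
  | h_x =>
    rw [comul_x, counit_x, map_add, LinearMap.lTensor_tmul, LinearMap.lTensor_tmul, map_add,
      LinearMap.mul'_apply, LinearMap.mul'_apply, antipode_ofTaft, antipode_ofTaft,
      Taft.antipode_x, Taft.antipode_h, ← map_mul, map_neg, one_mul, map_zero, add_neg_cancel]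
  | h_of g =>
    rw [comul_of, counit_of, LinearMap.lTensor_tmul, LinearMap.mul'_apply, antipode_of,
      of_mul_of_inv, map_one]
  | h_mul a b ha hb => exact mul_lTensor_comul_mul (antipode_mul hm hq χ) ha hb
  | h_add a b ha hb => simp only [map_add, ha, hb]

instance : HopfAlgebra K (Smash hm hq χ) where
  antipode := antipode hm hq χ
  mul_antipode_rTensor_comul := LinearMap.ext (mul_antipode_rTensor_comul hm hq χ)
  mul_antipode_lTensor_comul := LinearMap.ext (mul_antipode_lTensor_comul hm hq χ)

end Smash

/-! ### The factorization of the smash product -/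

theorem injective_left_of_bijective_factorMap {K : Type u} [Field K] {m : ℕ} {q : K} {hm : 2 ≤ m}
    {hq : IsPrimitiveRoot q m} {G : Type} [Group G] {E : Type w} [Ring E] [Bialgebra K E]
    {i : Taft hm hq →ₐc[K] E} {j : MonoidAlgebra K G →ₐc[K] E}
    (hb : Function.Bijective (factorMap i j)) : Function.Injective i := by
  have h1 : ∀ a, i a = factorMap i j (a ⊗ₜ 1) := fun a => by simp [factorMap]
  intro a b hab
  rw [h1, h1] at hab
  exact Algebra.TensorProduct.includeLeft_injective (S := K) (algebraMap K _).injective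
    (hb.1 hab)

theorem injective_right_of_bijective_factorMap {K : Type u} [Field K] {m : ℕ} [NeZero m] {q : K}
    {hm : 2 ≤ m} {hq : IsPrimitiveRoot q m} {G : Type} [Group G] {E : Type w} [Ring E]
    [Bialgebra K E] {i : Taft hm hq →ₐc[K] E} {j : MonoidAlgebra K G →ₐc[K] E}
    (hb : Function.Bijective (factorMap i j)) : Function.Injective j := by
  -- The map `b ↦ 1 ⊗ b` is injective only if the left factor is nontrivial; here `x ≠ 0`, as its
  -- image in `E` is nonzero.
  have : Nontrivial (Taft hm hq) := ⟨_, _, fun h => map_x_ne_zero hb ((congrArg i h).trans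
    (map_zero i))⟩
  have h1 : ∀ a, j a = factorMap i j (1 ⊗ₜ a) := fun a => by simp [factorMap]
  intro a b hab
  rw [h1, h1] at hab
  exact Algebra.TensorProduct.includeRight_injective (algebraMap K _).injective (hb.1 hab)

namespace Taft

variable {K : Type u} [Field K] {m : ℕ} {q : K} (hm : 2 ≤ m) (hq : IsPrimitiveRoot q m)

/-- The endomorphism of the Taft algebra that fixes `h` and scales `x`. -/
def scale (c : K) : Taft hm hq →ₐ[K] Taft hm hq :=
  lift hm hq (h hm hq) (c • x hm hq) (h_pow hm hq) (by rw [smul_pow, x_pow, smul_zero])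
    (by rw [smul_mul_assoc, x_mul_h, mul_smul_comm, smul_comm])

theorem scale_h (c : K) : scale hm hq c (h hm hq) = h hm hq := lift_h ..

theorem scale_x (c : K) : scale hm hq c (x hm hq) = c • x hm hq := lift_x ..

theorem scale_one : scale hm hq 1 = AlgHom.id K _ := by
  apply algHom_ext
  · rw [scale_h, AlgHom.id_apply]
  · rw [scale_x, AlgHom.id_apply, one_smul]

theorem scale_mul (c d : K) : scale hm hq (c * d) = (scale hm hq c).comp (scale hm hq d) := by
  apply algHom_ext
  · rw [AlgHom.comp_apply, scale_h, scale_h, scale_h]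
  · rw [AlgHom.comp_apply, scale_x, scale_x, map_smul, scale_x, smul_smul, mul_comm]

end Taft

namespace Smash

variable {K : Type u} [Field K] {m : ℕ} {q : K} (hm : 2 ≤ m) (hq : IsPrimitiveRoot q m)
  {G : Type} [Group G] (χ : G →* K)

section Lift

variable {χ} {B : Type v} [Ring B] [Bialgebra K B] (f : Taft hm hq →ₐc[K] B) (w : G →* B)
  (hh : ∀ g, w g * f (Taft.h hm hq) = f (Taft.h hm hq) * w g)
  (hx : ∀ g, w g * f (Taft.x hm hq) = χ g • (f (Taft.x hm hq) * w g))
  (hw : ∀ g, IsGroupLikeElem K (w g))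

/-- The universal property of the smash product among bialgebras. -/
def liftBialg : Smash hm hq χ →ₐc[K] B :=
  have h1 : ∀ a, lift hm hq (f : Taft hm hq →ₐ[K] B) w hh hx (ofTaft hm hq χ a) = f a :=
    lift_ofTaft hm hq (f : Taft hm hq →ₐ[K] B) w hh hx
  have h2 : ∀ g, lift hm hq (f : Taft hm hq →ₐ[K] B) w hh hx (of hm hq χ g) = w g :=
    lift_of hm hq (f : Taft hm hq →ₐ[K] B) w hh hx
  BialgHom.ofAlgHom (lift hm hq (f : Taft hm hq →ₐ[K] B) w hh hx)
    (by
      apply algHom_ext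
      · simp [h1, counit_h, (isGroupLikeElem_h f).counit_eq_one]
      · simp [h1, counit_x, Taft.counit_x]
      · simp [h2, counit_of, (hw _).counit_eq_one])
    (by
      apply algHom_ext
      · simp [h1, comul_h, (isGroupLikeElem_h f).comul_eq_tmul_self]
      · simp [h1, comul_x, comul_map_x]
      · simp [h2, comul_of, (hw _).comul_eq_tmul_self])

theorem liftBialg_of (g : G) : liftBialg hm hq f w hh hx hw (of hm hq χ g) = w g :=
  lift_of ..

theorem liftBialg_ofTaft (a : Taft hm hq) :
    liftBialg hm hq f w hh hx hw (ofTaft hm hq χ a) = f a :=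
  lift_ofTaft ..

end Lift

/-- The inclusion of the Taft algebra as a bialgebra map. -/
def inl : Taft hm hq →ₐc[K] Smash hm hq χ :=
  BialgHom.ofAlgHom (ofTaft hm hq χ)
    (by
      apply Taft.algHom_ext
      · simp [counit_h, Taft.counit_h]
      · simp [counit_x, Taft.counit_x])
    (by
      apply Taft.algHom_ext
      · simp [comul_h, Taft.comul_h]
      · simp [comul_x, Taft.comul_x])

theorem inl_apply (a : Taft hm hq) : inl hm hq χ a = ofTaft hm hq χ a := rfl

theorem isGroupLikeElem_of (g : G) : IsGroupLikeElem K (of hm hq χ g) :=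
  ⟨counit_of hm hq χ g, comul_of hm hq χ g⟩

/-- The inclusion of the group algebra as a bialgebra map. -/
def inr : MonoidAlgebra K G →ₐc[K] Smash hm hq χ :=
  BialgHom.ofAlgHom (MonoidAlgebra.lift K _ G (of hm hq χ))
    (by
      apply MonoidAlgebra.algHom_ext
      · intro g
        simp [counit_of]
      · ext)
    (by
      apply MonoidAlgebra.algHom_ext
      · intro g
        simp [comul_of]
      · ext)

theorem inr_single (g : G) (r : K) :
    inr hm hq χ (MonoidAlgebra.single g r) = r • of hm hq χ g :=
  MonoidAlgebra.lift_single _ _ _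

theorem ofGroup_inr (g : G) : ofGroup (inr hm hq χ) g = of hm hq χ g := by
  simp [inr_single]

theorem hasCharacter : HasCharacter (inl hm hq χ) (inr hm hq χ) χ where
  mul_h g := by
    rw [ofGroup_inr]
    exact of_mul_h hm hq χ g
  mul_x g := by
    rw [ofGroup_inr]
    exact of_mul_x hm hq χ g

theorem of_mul_ofTaft (g : G) (a : Taft hm hq) :
    of hm hq χ g * ofTaft hm hq χ a = ofTaft hm hq χ (Taft.scale hm hq (χ g) a) * of hm hq χ g := by
  induction a using Taft.induction with
  | h_alg r => rw [AlgHom.commutes, AlgHom.commutes, AlgHom.commutes, Algebra.commutes]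
  | h_h => rw [Taft.scale_h, of_mul_h]
  | h_x => rw [Taft.scale_x, of_mul_x, map_smul, smul_mul_assoc]
  | h_mul a b ha hb => rw [map_mul, map_mul, map_mul, ← mul_assoc, ha, mul_assoc, hb, mul_assoc]
  | h_add a b ha hb => rw [map_add, map_add, map_add, mul_add, add_mul, ha, hb]

theorem factorMap_tmul (a : Taft hm hq) (g : G) (r : K) :
    factorMap (inl hm hq χ) (inr hm hq χ) (a ⊗ₜ MonoidAlgebra.single g r) =
      r • (ofTaft hm hq χ a * of hm hq χ g) := by
  simp [factorMap, inr_single, inl_apply]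

/-- The range contains `1` and is stable under left multiplication by generators: `of_mul_ofTaft`
moves group elements to the right past the Taft algebra. -/
theorem surjective_factorMap : Function.Surjective (factorMap (inl hm hq χ) (inr hm hq χ)) := by
  rw [← LinearMap.range_eq_top]
  set S := LinearMap.range (factorMap (inl hm hq χ) (inr hm hq χ))
  have hmem : ∀ a g, ofTaft hm hq χ a * of hm hq χ g ∈ S := fun a g =>
    ⟨a ⊗ₜ MonoidAlgebra.single g 1, by rw [factorMap_tmul, one_smul]⟩
  have key : ∀ y, (∀ a g, y * (ofTaft hm hq χ a * of hm hq χ g) ∈ S) →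
      S ≤ S.comap (LinearMap.mulLeft K y) := by
    rintro y hy _ ⟨t, rfl⟩
    induction t with
    | zero => simp
    | add t t' ht ht' =>
      rw [map_add]
      exact Submodule.add_mem _ ht ht'
    | tmul a b =>
      induction b using MonoidAlgebra.induction_linear with
      | zero => simp
      | add b b' hb hb' =>
        rw [TensorProduct.tmul_add, map_add]
        exact Submodule.add_mem _ hb hb'
      | single g r =>
        rw [factorMap_tmul]
        exact Submodule.smul_mem _ r (hy a g)
  have hall : ∀ y : Smash hm hq χ, S ≤ S.comap (LinearMap.mulLeft K y) := by
    intro y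
    induction y using induction with
    | h_alg r =>
      intro s hs
      rw [Submodule.mem_comap, LinearMap.mulLeft_apply, ← Algebra.smul_def]
      exact S.smul_mem r hs
    | h_h =>
      refine key _ fun a g => ?_
      rw [← mul_assoc, ← map_mul]
      exact hmem _ _
    | h_x =>
      refine key _ fun a g => ?_
      rw [← mul_assoc, ← map_mul]
      exact hmem _ _
    | h_of g' =>
      refine key _ fun a g => ?_
      rw [← mul_assoc, of_mul_ofTaft, mul_assoc, ← map_mul]
      exact hmem _ _
    | h_mul a b ha hb =>
      intro s hs
      rw [Submodule.mem_comap, LinearMap.mulLeft_apply, mul_assoc]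
      exact ha (hb hs)
    | h_add a b ha hb =>
      intro s hs
      rw [Submodule.mem_comap, LinearMap.mulLeft_apply, add_mul]
      exact S.add_mem (ha hs) (hb hs)
  refine eq_top_iff.2 fun y _ => ?_
  have h1 : (1 : Smash hm hq χ) ∈ S := by
    have := hmem 1 1
    rwa [map_one, map_one, one_mul] at this
  have := hall y h1
  rwa [Submodule.mem_comap, LinearMap.mulLeft_apply, mul_one] at this

/-- The action of `G` on the Taft algebra, twisted by the regular representation of `G`. -/
def repGroup : G →* Module.End K (Taft hm hq) ⊗[K] MonoidAlgebra K G where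
  toFun g := (Taft.scale hm hq (χ g)).toLinearMap ⊗ₜ[K] MonoidAlgebra.single g (1 : K)
  map_one' := by
    rw [map_one, Taft.scale_one]
    rfl
  map_mul' g g' := by
    rw [map_mul, Taft.scale_mul, Algebra.TensorProduct.tmul_mul_tmul,
      MonoidAlgebra.single_mul_single, mul_one]
    rfl

theorem repGroup_apply (g : G) : repGroup hm hq χ g =
    (Taft.scale hm hq (χ g)).toLinearMap ⊗ₜ[K] MonoidAlgebra.single g (1 : K) := rfl

/-- The representation on the Taft algebra, twisted by the regular representation of `G`. -/
def rep : Smash hm hq χ →ₐ[K] Module.End K (Taft hm hq) ⊗[K] MonoidAlgebra K G :=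
  lift (χ := χ) (B := Module.End K (Taft hm hq) ⊗[K] MonoidAlgebra K G) hm hq
    (Algebra.TensorProduct.includeLeft.comp (Algebra.lmul K (Taft hm hq)))
    (repGroup hm hq χ)
    (fun g => by
      simp only [repGroup_apply, AlgHom.comp_apply, Algebra.TensorProduct.includeLeft_apply,
        Algebra.TensorProduct.tmul_mul_tmul, mul_one, one_mul]
      congr 1
      refine LinearMap.ext fun a => ?_
      simp [Taft.scale_h])
    (fun g => by
      simp only [repGroup_apply, AlgHom.comp_apply, Algebra.TensorProduct.includeLeft_apply,
        Algebra.TensorProduct.tmul_mul_tmul, mul_one, one_mul, TensorProduct.smul_tmul']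
      congr 1
      refine LinearMap.ext fun a => ?_
      simp [Taft.scale_x])

/-- The representation followed by evaluation at `1` is a left inverse: `a * g` becomes left
multiplication by `a` after a scaling that fixes `1`, tensored with `g`, and so evaluates to `a ⊗
g`. The group algebra factor records `g`, which the scaling alone would forget. -/
theorem injective_factorMap : Function.Injective (factorMap (inl hm hq χ) (inr hm hq χ)) := by
  suffices H : (LinearMap.applyₗ (R := K) (M₂ := Taft hm hq) (1 : Taft hm hq)).rTensor
      (MonoidAlgebra K G) ∘ₗ (rep hm hq χ).toLinearMap ∘ₗ
        factorMap (inl hm hq χ) (inr hm hq χ) = LinearMap.id by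
    intro s t hst
    have h1 := LinearMap.congr_fun H s
    have h2 := LinearMap.congr_fun H t
    rw [LinearMap.comp_apply, LinearMap.comp_apply] at h1 h2
    rw [hst, h2] at h1
    exact h1.symm
  refine TensorProduct.ext' fun a b => ?_
  induction b using MonoidAlgebra.induction_linear with
  | zero => simp
  | add b b' hb hb' => rw [TensorProduct.tmul_add, map_add, map_add, hb, hb']
  | single g r =>
    rw [LinearMap.comp_apply, LinearMap.comp_apply, factorMap_tmul, map_smul, map_smul]
    simp [rep, lift_of, lift_ofTaft, repGroup_apply, ← TensorProduct.tmul_smul]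

theorem bijective_factorMap : Function.Bijective (factorMap (inl hm hq χ) (inr hm hq χ)) :=
  ⟨injective_factorMap hm hq χ, surjective_factorMap hm hq χ⟩

theorem factorizesThrough :
    FactorizesThrough K (Taft hm hq) (MonoidAlgebra K G) (Smash hm hq χ) := by
  have : NeZero m := ⟨by omega⟩
  have hb := bijective_factorMap hm hq χ
  exact ⟨inl hm hq χ, inr hm hq χ, injective_left_of_bijective_factorMap hb,
    injective_right_of_bijective_factorMap hb, hb⟩

variable {hm hq χ}

/-- A bialgebra that factorizes with character `χ` is isomorphic to the smash product. -/
theorem nonempty_bialgEquiv {E : Type w} [Ring E] [Bialgebra K E] {i : Taft hm hq →ₐc[K] E}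
    {j : MonoidAlgebra K G →ₐc[K] E} (hb : Function.Bijective (factorMap i j))
    (hχ : HasCharacter i j χ) : Nonempty (Smash hm hq χ ≃ₐc[K] E) := by
  let Φ := liftBialg hm hq i (ofGroup j) hχ.mul_h hχ.mul_x (isGroupLikeElem_ofGroup j)
  -- `Φ` carries one factorization map to the other; both are bijective, hence so is `Φ`.
  have hΦ : Φ ∘ factorMap (inl hm hq χ) (inr hm hq χ) = factorMap i j := by
    suffices H : (Φ : Smash hm hq χ →ₗ[K] E) ∘ₗ factorMap (inl hm hq χ) (inr hm hq χ) =
      factorMap i j from congrArg DFunLike.coe H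
    refine TensorProduct.ext' fun a b => ?_
    induction b using MonoidAlgebra.induction_linear with
    | zero => simp
    | add b b' hb hb' => rw [TensorProduct.tmul_add, map_add, map_add, hb, hb']
    | single g r =>
      rw [LinearMap.comp_apply, factorMap_tmul, map_smul]
      have h1 : j (MonoidAlgebra.single g r) = r • j (MonoidAlgebra.single g 1) := by
        rw [← map_smul, MonoidAlgebra.smul_single, smul_eq_mul, mul_one]
      simp [Φ, liftBialg_of, liftBialg_ofTaft, factorMap, h1]
  exact ⟨BialgEquiv.ofBijective Φ ((Function.Bijective.of_comp_iff Φ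
    (bijective_factorMap hm hq χ)).1 (hΦ ▸ hb))⟩

/-- Isomorphic smash products have the same character, up to an injective endomorphism of `G` and
up to `m`-th roots of unity. -/
theorem exists_pow_eq_of_bialgEquiv {χ' : G →* K} (e : Smash hm hq χ' ≃ₐc[K] Smash hm hq χ) :
    ∃ v : G →* G, Function.Injective v ∧ ∀ g, χ' g ^ m = χ (v g) ^ m := by
  have : NeZero m := ⟨by omega⟩
  -- Transporting the factorization along `e` gives a second factorization of the same Hopf algebra,
  -- with character `χ'`.
  let i' := (e : Smash hm hq χ' →ₐc[K] Smash hm hq χ).comp (inl hm hq χ')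
  let j' := (e : Smash hm hq χ' →ₐc[K] Smash hm hq χ).comp (inr hm hq χ')
  have hcomp : factorMap i' j' = (e : Smash hm hq χ' →ₗ[K] Smash hm hq χ) ∘ₗ
      factorMap (inl hm hq χ') (inr hm hq χ') := by
    refine TensorProduct.ext' fun a b => ?_
    simp [factorMap, i', j']
  have hb' : Function.Bijective (factorMap i' j') := by
    rw [hcomp]
    exact (EquivLike.bijective e).comp (bijective_factorMap hm hq χ')
  refine (hasCharacter hm hq χ).exists_pow_eq (bijective_factorMap hm hq χ) hb'
    ⟨fun g => ?_, fun g => ?_⟩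
  · have := congrArg e ((hasCharacter hm hq χ').mul_h g)
    rwa [map_mul, map_mul] at this
  · have := congrArg e ((hasCharacter hm hq χ').mul_x g)
    rwa [map_mul, map_smul, map_mul] at this

end Smash

/-! ### Isomorphisms between smash products -/

namespace Smash

variable {K : Type u} [Field K] {m : ℕ} {q : K} (hm : 2 ≤ m) (hq : IsPrimitiveRoot q m)
  {G : Type} [Group G]

/-- A group automorphism identifies the smash products by `χ` and by its pullback. -/
theorem nonempty_bialgEquiv_comp (χ : G →* K) (v : G ≃* G) :
    Nonempty (Smash hm hq (χ.comp (v : G →* G)) ≃ₐc[K] Smash hm hq χ) := by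
  obtain ⟨Φ, hΦ, hΦ'⟩ : ∃ Φ : Smash hm hq (χ.comp (v : G →* G)) →ₐc[K] Smash hm hq χ,
      (∀ a, Φ (ofTaft hm hq _ a) = ofTaft hm hq χ a) ∧
        ∀ g, Φ (of hm hq _ g) = of hm hq χ (v g) :=
    ⟨liftBialg hm hq (inl hm hq χ) ((of hm hq χ).comp (v : G →* G))
      (fun g => of_mul_h hm hq χ (v g)) (fun g => of_mul_x hm hq χ (v g))
      (fun g => isGroupLikeElem_of hm hq χ (v g)), fun _ => liftBialg_ofTaft .., fun _ => liftBialg_of ..⟩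
  obtain ⟨Ψ, hΨ, hΨ'⟩ : ∃ Ψ : Smash hm hq χ →ₐc[K] Smash hm hq (χ.comp (v : G →* G)),
      (∀ a, Ψ (ofTaft hm hq χ a) = ofTaft hm hq _ a) ∧
        ∀ g, Ψ (of hm hq χ g) = of hm hq _ (v.symm g) :=
    ⟨liftBialg hm hq (inl hm hq _) ((of hm hq _).comp (v.symm : G →* G))
      (fun g => of_mul_h hm hq _ (v.symm g))
      (fun g => (of_mul_x hm hq _ (v.symm g)).trans (by simp [inl_apply]))
      (fun g => isGroupLikeElem_of hm hq _ (v.symm g)), fun _ => liftBialg_ofTaft .., fun _ => liftBialg_of ..⟩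
  refine ⟨BialgEquiv.ofBialgHom Φ Ψ (BialgHom.coe_toAlgHom_injective (algHom_ext ?_ ?_ ?_))
    (BialgHom.coe_toAlgHom_injective (algHom_ext ?_ ?_ ?_))⟩ <;>
  simp [hΦ, hΦ', hΨ, hΨ']

section Twist

variable {ψ : G →* K} (hψ : ∀ g, ψ g = 1 ∨ ψ g = -1)

open Classical in
/-- The homomorphism to the powers of `h` that takes the value `h ^ (m / 2)` where `ψ` is not
one. -/
def signPow (hm2 : Even m) (hψ : ∀ g, ψ g = 1 ∨ ψ g = -1) : G →* Taft hm hq where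
  toFun g := Taft.h hm hq ^ (if ψ g = 1 then 0 else m / 2)
  map_one' := by simp
  map_mul' g g' := by
    have h1 : Taft.h hm hq ^ (m / 2) * Taft.h hm hq ^ (m / 2) = 1 := by
      rw [← pow_add, ← two_mul, Nat.two_mul_div_two_of_even hm2, Taft.h_pow]
    rw [map_mul]
    -- If `-1 = 1`, then `ψ` is trivial and all exponents are zero. Otherwise the values multiply
    -- like signs, because `h ^ (m / 2)` is an involution.
    by_cases hc : (-1 : K) = 1
    · have h3 : ∀ g, ψ g = 1 := fun g => (hψ g).elim id fun h => h.trans hc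
      simp [h3]
    · rcases hψ g with h3 | h3 <;> rcases hψ g' with h4 | h4 <;> simp [h3, h4, hc, h1]

theorem exists_signPow_eq (hm2 : Even m) (g : G) : ∃ k : ℕ, signPow hm hq hm2 hψ g =
    Taft.h hm hq ^ k :=
  ⟨_, rfl⟩

-- This is why even `m` behaves differently: `h ^ (m / 2)` anticommutes with `x`, so it can absorb a
-- sign in the character.
include hq in
theorem pow_half_eq_neg_one (hm : 2 ≤ m) (hm2 : Even m) : q ^ (m / 2) = -1 := by
  have h1 : q ^ (m / 2) * q ^ (m / 2) = 1 := by
    rw [← pow_add, ← two_mul, Nat.two_mul_div_two_of_even hm2, hq.pow_eq_one]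
  exact (mul_self_eq_one_iff.1 h1).resolve_left
    (hq.pow_ne_one_of_pos_of_lt (by omega) (by omega))

theorem x_mul_signPow (hm2 : Even m) (g : G) : Taft.x hm hq * signPow hm hq hm2 hψ g =
    ψ g • (signPow hm hq hm2 hψ g * Taft.x hm hq) := by
  rw [signPow, MonoidHom.coe_mk, OneHom.coe_mk, Taft.x_mul_h_pow]
  split_ifs with h
  · rw [h, pow_zero]
  · rw [(hψ g).resolve_left h, pow_half_eq_neg_one hq hm hm2]

theorem signPow_mul_self (hm2 : Even m) (g : G) :
    signPow hm hq hm2 hψ g * signPow hm hq hm2 hψ g = 1 := by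
  rw [signPow, MonoidHom.coe_mk, OneHom.coe_mk, ← pow_add, ← two_mul]
  split_ifs
  · rw [mul_zero, pow_zero]
  · rw [Nat.two_mul_div_two_of_even hm2, Taft.h_pow]

/-- The embedding of `G` twisted by `signPow`. -/
def twistedOf (hm2 : Even m) (hψ : ∀ g, ψ g = 1 ∨ ψ g = -1) (χ : G →* K) :
    G →* Smash hm hq χ where
  toFun g := ofTaft hm hq χ (signPow hm hq hm2 hψ g) * of hm hq χ g
  map_one' := by simp
  map_mul' g g' := by
    obtain ⟨k, hk⟩ := exists_signPow_eq hm hq hψ hm2 g'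
    rw [map_mul, map_mul, map_mul, hk, mul_assoc, mul_assoc,
      ← mul_assoc (of hm hq χ g) (ofTaft hm hq χ _), (commute_of_h_pow hm hq χ g k).eq, mul_assoc]

theorem twistedOf_apply (hm2 : Even m) (χ : G →* K) (g : G) : twistedOf hm hq hm2 hψ χ g =
    ofTaft hm hq χ (signPow hm hq hm2 hψ g) * of hm hq χ g := rfl

/-- The map between smash products given by `twistedOf`. -/
def twistHom (hm2 : Even m) (hψ : ∀ g, ψ g = 1 ∨ ψ g = -1) {χ χ' : G →* K}
    (hχ : ∀ g, χ' g = χ g * ψ g) : Smash hm hq χ →ₐc[K] Smash hm hq χ' :=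
  liftBialg hm hq (inl hm hq χ') (twistedOf hm hq hm2 hψ χ')
    (fun g => by
      obtain ⟨k, hk⟩ := exists_signPow_eq hm hq hψ hm2 g
      rw [twistedOf_apply, inl_apply, mul_assoc, of_mul_h, ← mul_assoc, ← mul_assoc, ← map_mul,
        ← map_mul, hk, ← pow_succ, ← pow_succ'])
    (fun g => by
      rw [twistedOf_apply, inl_apply, mul_assoc, of_mul_x, mul_smul_comm, ← mul_assoc, ← mul_assoc,
        ← map_mul, ← map_mul, x_mul_signPow, map_smul, smul_mul_assoc, smul_smul, hχ])
    (fun g => by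
      obtain ⟨k, hk⟩ := exists_signPow_eq hm hq hψ hm2 g
      rw [twistedOf_apply, hk, map_pow]
      exact (isGroupLikeElem_h (inl hm hq χ')).pow.mul (isGroupLikeElem_of hm hq χ' g))

theorem twistHom_twistHom (hm2 : Even m) {χ χ' : G →* K} (hχ : ∀ g, χ' g = χ g * ψ g)
    (hχ' : ∀ g, χ g = χ' g * ψ g) :
    (twistHom hm hq hm2 hψ hχ').comp (twistHom hm hq hm2 hψ hχ) = BialgHom.id K _ := by
  refine BialgHom.coe_toAlgHom_injective (algHom_ext ?_ ?_ fun g => ?_)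
  · simp [twistHom, liftBialg_ofTaft, inl_apply]
  · simp [twistHom, liftBialg_ofTaft, inl_apply]
  · simp only [twistHom, BialgHom.comp_toAlgHom, AlgHom.comp_apply, BialgHom.coe_toAlgHom,
      liftBialg_of, twistedOf_apply, map_mul, liftBialg_ofTaft, inl_apply, BialgHom.id_apply]
    rw [← mul_assoc, ← map_mul, signPow_mul_self, map_one, one_mul]

include hψ in
/-- For even `m`, the smash product does not change when a character with values `±1` is
multiplied into `χ`. -/
theorem nonempty_bialgEquiv_mul (hm2 : Even m) {χ χ' : G →* K} (hχ : ∀ g, χ' g = χ g * ψ g) :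
    Nonempty (Smash hm hq χ ≃ₐc[K] Smash hm hq χ') := by
  have hχ' : ∀ g, χ g = χ' g * ψ g := fun g => by
    rw [hχ, mul_assoc, mul_self_eq_one_iff.2 (hψ g), mul_one]
  exact ⟨BialgEquiv.ofBialgHom (twistHom hm hq hm2 hψ hχ) (twistHom hm hq hm2 hψ hχ')
    (twistHom_twistHom hm hq hψ hm2 hχ' hχ) (twistHom_twistHom hm hq hψ hm2 hχ hχ')⟩

end Twist

end Smash

/-- The number of factorization types is the size of a system of representatives for the characters
up to isomorphism of smash products. -/
theorem card_factorizationTypes {K : Type u} [Field K] {m : ℕ} {q : K} (hm : 2 ≤ m)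
    (hq : IsPrimitiveRoot q m) {G : Type} [Group G] {N : ℕ} (c : Fin N → G →* K)
    (hinj : ∀ a b, Nonempty (Smash hm hq (c a) ≃ₐc[K] Smash hm hq (c b)) → a = b)
    (hsurj : ∀ χ : G →* K, ∃ a, Nonempty (Smash hm hq χ ≃ₐc[K] Smash hm hq (c a))) :
    Nat.card (FactorizationTypes K (Taft hm hq) (MonoidAlgebra K G)) = N := by
  have : NeZero m := ⟨by omega⟩
  let s := factorizationSetoid K (Taft hm hq) (MonoidAlgebra K G)
  let F : Fin N → FactorizationTypes K (Taft hm hq) (MonoidAlgebra K G) := fun a =>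
    Quotient.mk s ⟨HopfAlgCat.of K (Smash hm hq (c a)), Smash.factorizesThrough hm hq (c a)⟩
  have hF : Function.Bijective F := by
    refine ⟨fun a b hab => hinj a b (Quotient.exact hab), fun t => ?_⟩
    induction t using Quotient.inductionOn with
    | h E =>
      obtain ⟨E, i, j, -, -, hb⟩ := E
      obtain ⟨χ, hχ⟩ := exists_hasCharacter (i := i) (j := j) hb
      obtain ⟨e⟩ := Smash.nonempty_bialgEquiv hb hχ
      obtain ⟨a, ⟨f⟩⟩ := hsurj χ
      exact ⟨a, Quotient.sound ⟨f.symm.trans e⟩⟩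
  rw [← Nat.card_eq_of_bijective F hF, Nat.card_fin]

/-! ### Characters of dihedral groups -/

namespace Dihedral

open DihedralGroup

variable {K : Type u} [Field K] {n : ℕ}

theorem map_mul_self_sr (χ : DihedralGroup n →* K) (i : ZMod n) : χ (sr i) * χ (sr i) = 1 := by
  rw [← map_mul, sr_mul_self, map_one]

/-- Reflections are involutions, every rotation is a product of two reflections, and `K` is
commutative. -/
theorem map_mul_self (χ : DihedralGroup n →* K) (g : DihedralGroup n) : χ g * χ g = 1 := by
  cases g with
  | sr i => exact map_mul_self_sr χ i
  | r i =>
    have h1 : (r i : DihedralGroup n) = sr 0 * sr i := by simp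
    rw [h1, map_mul, mul_mul_mul_comm, map_mul_self_sr, map_mul_self_sr, mul_one]

theorem map_eq_one_or (χ : DihedralGroup n →* K) (g : DihedralGroup n) :
    χ g = 1 ∨ χ g = -1 :=
  mul_self_eq_one_iff.1 (map_mul_self χ g)

variable [NeZero n]

theorem map_r (χ : DihedralGroup n →* K) (i : ZMod n) : χ (r i) = χ (r 1) ^ i.val := by
  rw [← map_pow, r_one_pow, ZMod.natCast_zmod_val]

theorem hom_ext {χ χ' : DihedralGroup n →* K} (h1 : χ (r 1) = χ' (r 1))
    (h2 : χ (sr 0) = χ' (sr 0)) : χ = χ' := by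
  ext g
  cases g with
  | r i => rw [map_r, map_r χ', h1]
  | sr i =>
    have h3 : (sr i : DihedralGroup n) = sr 0 * r i := by simp
    rw [h3, map_mul, map_mul, map_r, map_r χ', h1, h2]

/-- The character that takes the value `ε` at the rotation `r 1` and `δ` at the reflection
`sr 0`. -/
def char (ε δ : K) (hε : ε * ε = 1) (hεn : ε ^ n = 1) (hδ : δ * δ = 1) : DihedralGroup n →* K where
  toFun
    | r i => ε ^ i.val
    | sr i => δ * ε ^ i.val
  map_one' := by
    rw [one_def]
    simp
  map_mul' := by
    have hs : ∀ i : ZMod n, ε ^ i.val * ε ^ i.val = 1 := fun i => by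
      rw [← mul_pow, hε, one_pow]
    -- As `ε` is its own inverse, the inversion of rotations by reflections does not affect the
    -- values.
    have hsub : ∀ i j : ZMod n, ε ^ (j - i).val = ε ^ i.val * ε ^ j.val := fun i j => by
      have h1 := pow_zmodVal_add hεn (j - i) i
      rw [sub_add_cancel] at h1
      rw [h1, mul_comm, mul_assoc, hs, mul_one]
    rintro (i | i) (j | j)
    · exact pow_zmodVal_add hεn i j
    · change δ * ε ^ (j - i).val = ε ^ i.val * (δ * ε ^ j.val)
      rw [hsub]
      ring
    · change δ * ε ^ (i + j).val = δ * ε ^ i.val * ε ^ j.val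
      rw [pow_zmodVal_add hεn, mul_assoc]
    · change ε ^ (j - i).val = δ * ε ^ i.val * (δ * ε ^ j.val)
      rw [hsub]
      linear_combination -(ε ^ i.val * ε ^ j.val) * hδ

theorem char_r_one (hn : 3 ≤ n) {ε δ : K} (hε : ε * ε = 1) (hεn : ε ^ n = 1) (hδ : δ * δ = 1) :
    char ε δ hε hεn hδ (r 1) = ε := by
  have : Fact (1 < n) := ⟨by omega⟩
  change ε ^ (1 : ZMod n).val = ε
  rw [ZMod.val_one, pow_one]

theorem char_sr_zero {ε δ : K} (hε : ε * ε = 1) (hεn : ε ^ n = 1) (hδ : δ * δ = 1) :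
    char (n := n) ε δ hε hεn hδ (sr 0) = δ := by
  change δ * ε ^ (0 : ZMod n).val = δ
  rw [ZMod.val_zero, pow_zero, mul_one]

variable (n) in
/-- The automorphism that fixes the rotations and shifts the reflections. -/
def shift : DihedralGroup n ≃* DihedralGroup n where
  toFun
    | r i => r i
    | sr i => sr (i + 1)
  invFun
    | r i => r i
    | sr i => sr (i - 1)
  left_inv := by rintro (i | i) <;> simp
  right_inv := by rintro (i | i) <;> simp
  map_mul' := by rintro (i | i) (j | j) <;> simp <;> ring

theorem eq_one_of_pow_eq_one {a : K} (ha : a * a = 1) {m : ℕ} (hm : Odd m) (h : a ^ m = 1) :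
    a = 1 := by
  obtain ⟨k, rfl⟩ := hm
  rwa [pow_succ, pow_mul, pow_two, ha, one_pow, one_mul] at h

variable {m : ℕ} {q : K} {hm : 2 ≤ m} {hq : IsPrimitiveRoot q m} {χ χ' : DihedralGroup n →* K}

omit [NeZero n] in
theorem eq_one_of_bialgEquiv (hodd : Odd m) (e : Smash hm hq χ' ≃ₐc[K] Smash hm hq χ)
    (h : χ = 1) : χ' = 1 := by
  obtain ⟨v, -, hv⟩ := Smash.exists_pow_eq_of_bialgEquiv e
  ext g
  refine eq_one_of_pow_eq_one (map_mul_self χ' g) hodd ?_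
  rw [hv, h, MonoidHom.one_apply, one_pow]

/-- An injective `v` preserves the order `n ≥ 3` of `r 1`, while reflections have order two. So `v
(r 1)` is a rotation, on which `χ` is trivial. -/
theorem map_r_one_eq_one_of_bialgEquiv (hn : 3 ≤ n) (hodd : Odd m)
    (e : Smash hm hq χ' ≃ₐc[K] Smash hm hq χ) (h : χ (r 1) = 1) : χ' (r 1) = 1 := by
  obtain ⟨v, hinj, hv⟩ := Smash.exists_pow_eq_of_bialgEquiv e
  refine eq_one_of_pow_eq_one (map_mul_self χ' _) hodd ?_
  rw [hv]
  have hord : orderOf (v (r 1)) = n := by rw [orderOf_injective v hinj, orderOf_r_one]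
  generalize v (r 1) = g at hord
  cases g with
  | r i => rw [map_r, h, one_pow, one_pow]
  | sr i =>
    rw [orderOf_sr] at hord
    omega

end Dihedral

end TaftBicrossed

end

/-! ### Counting dihedral characters up to isomorphism of smash products -/

open TaftBicrossed DihedralGroup in
theorem card_factorizationTypes_of_odd_of_odd {K : Type u} [Field K] (h2 : (2 : K) ≠ 0) {m n : ℕ}
    (hm : 2 ≤ m) (hn : 3 ≤ n) {q : K} (hq : IsPrimitiveRoot q m) (hmo : Odd m) (hno : Odd n) :
    Nat.card (FactorizationTypes K (Taft hm hq) (MonoidAlgebra K (DihedralGroup n))) = 2 := by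
  have : NeZero n := ⟨by omega⟩
  have hne : (-1 : K) ≠ 1 := fun h => h2 (by linear_combination -h)
  let σ : DihedralGroup n →* K := Dihedral.char 1 (-1) (by simp) (by simp) (by simp)
  have hσ0 : σ (sr 0) = -1 := Dihedral.char_sr_zero ..
  have hσ1 : σ (r 1) = 1 := Dihedral.char_r_one hn ..
  have hσ : σ ≠ 1 := fun h => hne (by rw [← hσ0, h, MonoidHom.one_apply])
  refine card_factorizationTypes hm hq ![1, σ] ?_ fun χ => ?_
  · rintro a b ⟨e⟩
    fin_cases a <;> fin_cases b
    · rfl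
    · exact absurd (Dihedral.eq_one_of_bialgEquiv hmo e.symm rfl) hσ
    · exact absurd (Dihedral.eq_one_of_bialgEquiv hmo e rfl) hσ
    · rfl
  -- The value at `r 1` is a sign whose `n`-th power is `1`, so odd `n` forces it to be `1`.
  · have h1 : χ (r 1) = 1 := Dihedral.eq_one_of_pow_eq_one (Dihedral.map_mul_self χ _) hno
      (by rw [← map_pow, r_one_pow_n, map_one])
    rcases Dihedral.map_eq_one_or χ (sr 0) with h | h
    · obtain rfl : χ = 1 := Dihedral.hom_ext h1 h
      exact ⟨0, ⟨BialgEquiv.refl K _⟩⟩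
    · obtain rfl : χ = σ := Dihedral.hom_ext (h1.trans hσ1.symm) (h.trans hσ0.symm)
      exact ⟨1, ⟨BialgEquiv.refl K _⟩⟩

open TaftBicrossed DihedralGroup in
theorem card_factorizationTypes_of_odd_of_even {K : Type u} [Field K] (h2 : (2 : K) ≠ 0) {m n : ℕ}
    (hm : 2 ≤ m) (hn : 3 ≤ n) {q : K} (hq : IsPrimitiveRoot q m) (hmo : Odd m) (hne : Even n) :
    Nat.card (FactorizationTypes K (Taft hm hq) (MonoidAlgebra K (DihedralGroup n))) = 3 := by
  have : NeZero n := ⟨by omega⟩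
  have hne1 : (-1 : K) ≠ 1 := fun h => h2 (by linear_combination -h)
  let σ : DihedralGroup n →* K := Dihedral.char 1 (-1) (by simp) (by simp) (by simp)
  have hσ0 : σ (sr 0) = -1 := Dihedral.char_sr_zero ..
  have hσ1 : σ (r 1) = 1 := Dihedral.char_r_one hn ..
  have hσ : σ ≠ 1 := fun h => hne1 (by rw [← hσ0, h, MonoidHom.one_apply])
  let τ : DihedralGroup n →* K := Dihedral.char (-1) 1 (by simp) hne.neg_one_pow (by simp)
  have hτ0 : τ (sr 0) = 1 := Dihedral.char_sr_zero ..
  have hτ1 : τ (r 1) = -1 := Dihedral.char_r_one hn ..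
  have hτ : τ ≠ 1 := fun h => hne1 (by rw [← hτ1, h, MonoidHom.one_apply])
  have hτ1' : τ (r 1) ≠ 1 := hτ1 ▸ hne1
  refine card_factorizationTypes hm hq ![1, σ, τ] ?_ fun χ => ?_
  · rintro a b ⟨e⟩
    fin_cases a <;> fin_cases b
    · rfl
    · exact absurd (Dihedral.eq_one_of_bialgEquiv hmo e.symm rfl) hσ
    · exact absurd (Dihedral.eq_one_of_bialgEquiv hmo e.symm rfl) hτ
    · exact absurd (Dihedral.eq_one_of_bialgEquiv hmo e rfl) hσ
    · rfl
    · exact absurd (Dihedral.map_r_one_eq_one_of_bialgEquiv hn hmo e.symm hσ1) hτ1'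
    · exact absurd (Dihedral.eq_one_of_bialgEquiv hmo e rfl) hτ
    · exact absurd (Dihedral.map_r_one_eq_one_of_bialgEquiv hn hmo e hσ1) hτ1'
    · rfl
  · rcases Dihedral.map_eq_one_or χ (r 1) with h1 | h1 <;>
      rcases Dihedral.map_eq_one_or χ (sr 0) with h | h
    · obtain rfl : χ = 1 := Dihedral.hom_ext h1 h
      exact ⟨0, ⟨BialgEquiv.refl K _⟩⟩
    · obtain rfl : χ = σ := Dihedral.hom_ext (h1.trans hσ1.symm) (h.trans hσ0.symm)
      exact ⟨1, ⟨BialgEquiv.refl K _⟩⟩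
    · obtain rfl : χ = τ := Dihedral.hom_ext (h1.trans hτ1.symm) (h.trans hτ0.symm)
      exact ⟨2, ⟨BialgEquiv.refl K _⟩⟩
    -- The fourth character, `-1` on both generators, is the pullback of `τ` along `shift`, which
    -- sends `sr 0` to `sr 0 * r 1`.
    · have h3 : (sr (0 + 1) : DihedralGroup n) = sr 0 * r 1 := by simp
      obtain rfl : χ = τ.comp (Dihedral.shift n : DihedralGroup n →* DihedralGroup n) := by
        refine Dihedral.hom_ext (h1.trans hτ1.symm) (h.trans ?_)
        change -1 = τ (sr (0 + 1))
        rw [h3, map_mul, hτ0, hτ1, one_mul]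
      exact ⟨2, Smash.nonempty_bialgEquiv_comp hm hq τ (Dihedral.shift n)⟩

-- Twisting `χ` by itself gives the trivial character, since `χ` takes values `±1`; all smash
-- products then coincide.
open TaftBicrossed in
theorem card_factorizationTypes_of_even {K : Type u} [Field K] {m : ℕ} (n : ℕ) (hm : 2 ≤ m) {q : K}
    (hq : IsPrimitiveRoot q m) (hme : Even m) :
    Nat.card (FactorizationTypes K (Taft hm hq) (MonoidAlgebra K (DihedralGroup n))) = 1 := by
  refine card_factorizationTypes hm hq ![1] (fun _ _ _ => Subsingleton.elim _ _) fun χ => ⟨0, ?_⟩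
  exact Smash.nonempty_bialgEquiv_mul hm hq (Dihedral.map_eq_one_or χ) hme
    fun g => (Dihedral.map_mul_self χ g).symm

theorem mainTheorem5 {K : Type u} [Field K] (h2 : (2 : K) ≠ 0) (m n : ℕ) (hm : 2 ≤ m) (hn : 3 ≤ n)
    (q : K) (hq : IsPrimitiveRoot q m) :
    (Odd m → Odd n →
      Nat.card (TaftBicrossed.FactorizationTypes K (TaftBicrossed.Taft hm hq)
        (MonoidAlgebra K (DihedralGroup n))) = 2) ∧
    (Odd m → Even n →
      Nat.card (TaftBicrossed.FactorizationTypes K (TaftBicrossed.Taft hm hq)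
        (MonoidAlgebra K (DihedralGroup n))) = 3) ∧
    (Even m →
      Nat.card (TaftBicrossed.FactorizationTypes K (TaftBicrossed.Taft hm hq)
        (MonoidAlgebra K (DihedralGroup n))) = 1) :=
  ⟨card_factorizationTypes_of_odd_of_odd h2 hm hn hq,
    card_factorizationTypes_of_odd_of_even h2 hm hn hq,
    card_factorizationTypes_of_even n hm hq⟩
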